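/- Let $F$ be a real quadratic field with ring of integers $\mathcal O$, different $\mathfrak d$ and discriminant $D$; write $\mathbb A$ for its adeles, $\mathbb A_f$ for its finite adeles, $\widehat{\mathcal O}\subset\mathbb A_f$ for the integral finite adeles, $\mathbb H$ for the upper half plane, and $x\gg0$ for "totally positive". Two fractional ideals are in the same narrow class, written $\mathfrak a\sim\mathfrak b$, if $\mathfrak a=(a)\mathfrak b$ with $a\in F$, $a\gg0$. Let $t_\nu$ be finite ideles whose ideals $t_\nu\mathcal O$ represent each narrow ideal class exactly once, and let $\nu=1$ be the index for which $t_1\mathcal O$ represents the trivial class. A narrow ideal class character is a character of $\mathbb A^\times$ trivial on $F^\times$, on the totally positive archimedean ideles and on the units of $\widehat{\mathcal O}$. For $k\in\mathbb Z$ let $\mathcal M_k$ be the space of functions $f:\mathrm{GL}_2(\mathbb A)\to\mathbb C$ that are left invariant under $\mathrm{GL}_2(F)$, right invariant under $$K=\left\{\begin{pmatrix}a&b\\c&d\end{pmatrix}\in\mathrm{GL}_2(\mathbb A_f):\ a,d\in\widehat{\mathcal O},\ b\in\mathfrak d^{-1}\widehat{\mathcal O},\ c\in\mathfrak d\widehat{\mathcal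 O},\ \det\in\widehat{\mathcal O}^\times\right\},$$ satisfy $f(gu)=(\det u)^{k/2}j(u,i)^{-k}f(g)$ for $u\in(\mathbb R^\times\mathrm{SO}_2(\mathbb R))^2$, and are such that for each $x\in\mathrm{GL}_2(\mathbb A_f)$ the function $f_x(z)=(\det g)^{-k/2}j(g,i)^kf(xg)$ (with $g\in\mathrm{GL}_2^+(\mathbb R)^2$, $g(i,i)=z$) is holomorphic on $\mathbb H^2$. Here $\det g$ is the product of the two determinants and $j(g,z)=(c_1z_1+d_1)(c_2z_2+d_2)$. For a narrow ideal class character $\psi$ let $\mathcal M_k(\psi)\subset\mathcal M_k$ consist of the $f$ with $f(ag)=\psi(a)f(g)$ for all $a\in\mathbb A^\times$. The components of $f\in\mathcal M_k$ are $f_\nu=f_x$ with $x=\mathrm{diag}(t_\nu^{-1},1)$; write $f=(f_\nu)$. They have Fourier expansions $f_\nu(z)=\sum_{\mu\in t_\nu\mathcal O}a_\nu(\mu)e^{2\pi i\,\mathrm{Tr}(\mu z)}$. With $N(t_\nu)$ the norm of the ideal $t_\nu\mathcal O$, put $c_\nu(0,f)=N(t_\nu)^{-k/2}a_\nu(0)$,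 and for a nonzero integral ideal $\mathfrak m=t_\nu^{-1}(\mu)$ with $\mu\in t_\nu\mathcal O$, $\mu\gg0$, put $c(\mathfrak m,f)=N(t_\nu)^{-k/2}a_\nu(\mu)$. Let $k_1,k_2\in\mathbb Z$, let $\psi_1,\psi_2$ be narrow ideal class characters, and let $f=(f_\nu)\in\mathcal M_{k_1}(\psi_1)$ and $h=(h_\nu)\in\mathcal M_{k_2}(\psi_2)$. Then the product $f\cdot h$ lies in $\mathcal M_{k_1+k_2}(\psi_1\psi_2)$ and $f\cdot h=(f_\nu\cdot h_\nu)$. The components of $f$, $h$ and $f\cdot h$ have absolutely convergent Fourier expansions as above, and: 1. For each $\nu$, $c_\nu(0,f\cdot h)=c_\nu(0,f)\,c_\nu(0,h)$. 2. $c(\mathcal O,f\cdot h)=c(\mathcal O,f)c_1(0,h)+c(\mathcal O,h)c_1(0,f)$. 3. $c((2),f\cdot h)=c_1(0,h)c((2),f)+c(\mathcal O,f)c(\mathcal O,h)+c_1(0,f)c((2),h)$. 4. If $(2)$ is inert, then $$\begin{aligned}c((4),f\cdot h)={}&c_1(0,h)c((4),f)+c(\mathcal O,f)c((3),h)+c((2),f)c((2),h)\\&+c(\mathcal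 O,h)c((3),f)+c_1(0,f)c((4),h)+\epsilon_4,\end{aligned}$$ where $\epsilon_4=2c(\mathfrak d,f)c(\mathcal O,h)+2c(\mathcal O,f)c(\mathfrak d,h)$ if $D=5$, and $\epsilon_4=0$ otherwise. 5. $c((3),f\cdot h)=c_1(0,h)c((3),f)+c(\mathcal O,f)c((2),h)+c(\mathcal O,h)c((2),f)+c_1(0,f)c((3),h)+\epsilon_3$, where $\epsilon_3=2c(\mathcal O,f)c(\mathcal O,h)$ if $D=5$, and $\epsilon_3=0$ otherwise. 6. If $\mathfrak p$ is a prime ideal with $(2)=\mathfrak p^2$, or with $(2)=\mathfrak p\mathfrak p'$ for a prime $\mathfrak p'\neq\mathfrak p$, then for the $\nu$ with $\mathfrak p\sim t_\nu^{-1}\mathcal O$, $$c(\mathfrak p,f\cdot h)=c_\nu(0,h)c(\mathfrak p,f)+c_\nu(0,f)c(\mathfrak p,h).$$ -/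

import Mathlib

open NumberField IsDedekindDomain UpperHalfPlane
open scoped nonZeroDivisors MatrixGroups

namespace HilbertModular

noncomputable section

variable (F : Type*) [Field F]

/-! ### Adeles of a totally real field -/

/-- The ring `𝔸` of adeles of `F`. -/
abbrev Adeles [NumberField F] := AdeleRing (𝓞 F) F

/-- The ring `𝔸_f` of finite adeles of `F`. -/
abbrev FinAdeles [NumberField F] := FiniteAdeleRing (𝓞 F) F

/-- The product of upper half planes indexed by the infinite places of `F`; this is `ℍ²` when `F`
is real quadratic. -/
abbrev HalfSpace := InfinitePlace F → ℍ

variable {F}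

/-- The real embedding of `F` attached to the infinite place `v`. -/
def realEmb [IsTotallyReal F] (v : InfinitePlace F) : F →+* ℝ :=
  InfinitePlace.embedding_of_isReal (IsTotallyReal.isReal v)

/-- The identification of the completion of `F` at `v` with `ℝ`. -/
def completionEquiv [IsTotallyReal F] (v : InfinitePlace F) : v.Completion ≃+* ℝ :=
  InfinitePlace.Completion.ringEquivRealOfIsReal (IsTotallyReal.isReal v)

/-- Totally positive elements of `F`. -/
def TotPos [IsTotallyReal F] (a : F) : Prop := ∀ v : InfinitePlace F, 0 < realEmb v a

variable [NumberField F]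

/-- The element of `GL₂(𝔸)` with finite part `x` and archimedean part `g`. -/
def adelicGL [IsTotallyReal F] (x : GL (Fin 2) (FinAdeles F))
    (g : InfinitePlace F → GL (Fin 2) ℝ) : GL (Fin 2) (Adeles F) where
  val := Matrix.of fun i j => (fun v => (completionEquiv v).symm ((g v).1 i j), x.1 i j)
  inv := Matrix.of fun i j => (fun v => (completionEquiv v).symm ((g v)⁻¹.1 i j), x⁻¹.1 i j)
  val_inv := by
    have hx : x.1 * x⁻¹.1 = 1 := x.mul_inv
    have hg : ∀ v, (g v).1 * (g v)⁻¹.1 = 1 := fun v => (g v).mul_inv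
    ext i j
    rw [Matrix.mul_apply, Fin.sum_univ_two]
    refine Prod.ext ?_ ?_
    · funext v
      have h := congrFun (congrFun (hg v) i) j
      rw [Matrix.mul_apply, Fin.sum_univ_two] at h
      refine (show _ = (completionEquiv v).symm ((1 : Matrix (Fin 2) (Fin 2) ℝ) i j) from ?_).trans
        ?_
      · rw [← h, map_add, map_mul, map_mul]; rfl
      · by_cases hij : i = j
        · subst hij; rw [Matrix.one_apply_eq, Matrix.one_apply_eq, map_one]; rfl
        · rw [Matrix.one_apply_ne hij, Matrix.one_apply_ne hij, map_zero]; rfl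
    · have h := congrFun (congrFun hx i) j
      rw [Matrix.mul_apply, Fin.sum_univ_two] at h
      refine (show _ = (1 : Matrix (Fin 2) (Fin 2) (FinAdeles F)) i j from h).trans ?_
      by_cases hij : i = j
      · subst hij; rw [Matrix.one_apply_eq, Matrix.one_apply_eq]; rfl
      · rw [Matrix.one_apply_ne hij, Matrix.one_apply_ne hij]; rfl
  inv_val := by
    have hx : x⁻¹.1 * x.1 = 1 := x.inv_mul
    have hg : ∀ v, (g v)⁻¹.1 * (g v).1 = 1 := fun v => (g v).inv_mul
    ext i j
    rw [Matrix.mul_apply, Fin.sum_univ_two]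
    refine Prod.ext ?_ ?_
    · funext v
      have h := congrFun (congrFun (hg v) i) j
      rw [Matrix.mul_apply, Fin.sum_univ_two] at h
      refine (show _ = (completionEquiv v).symm ((1 : Matrix (Fin 2) (Fin 2) ℝ) i j) from ?_).trans
        ?_
      · rw [← h, map_add, map_mul, map_mul]; rfl
      · by_cases hij : i = j
        · subst hij; rw [Matrix.one_apply_eq, Matrix.one_apply_eq, map_one]; rfl
        · rw [Matrix.one_apply_ne hij, Matrix.one_apply_ne hij, map_zero]; rfl
    · have h := congrFun (congrFun hx i) j
      rw [Matrix.mul_apply, Fin.sum_univ_two] at h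
      refine (show _ = (1 : Matrix (Fin 2) (Fin 2) (FinAdeles F)) i j from h).trans ?_
      by_cases hij : i = j
      · subst hij; rw [Matrix.one_apply_eq, Matrix.one_apply_eq]; rfl
      · rw [Matrix.one_apply_ne hij, Matrix.one_apply_ne hij]; rfl

/-! ### Ideals and ideles -/

/-- `x ∈ I·𝒪̂` for a nonzero fractional ideal `I`: at every finite place `v`, the order of `x` is at
least the order of `I`. -/
def MemIdealHat (I : FractionalIdeal (𝓞 F)⁰ F) (x : FinAdeles F) : Prop :=
  ∀ v : HeightOneSpectrum (𝓞 F),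
    Valued.v (x v) ≤ WithZero.exp (-(FractionalIdeal.count F v I))

/-- The fractional ideal `t𝒪 = ∏ᵥ 𝔭ᵥ ^ ordᵥ(t)` of a finite idele `t`. -/
def ideleIdeal (t : (FinAdeles F)ˣ) : FractionalIdeal (𝓞 F)⁰ F :=
  ∏ᶠ v : HeightOneSpectrum (𝓞 F),
    (v.asIdeal : FractionalIdeal (𝓞 F)⁰ F) ^ (-(WithZero.log (Valued.v (t.1 v))))

/-- The norm `N(t)` of the fractional ideal of a finite idele. -/
def ideleNorm (t : (FinAdeles F)ˣ) : ℝ := ((FractionalIdeal.absNorm (ideleIdeal t) : ℚ) : ℝ)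

/-- Two fractional ideals are in the same narrow class: `I = (a)J` with `a ≫ 0`. -/
def NarrowEquiv [IsTotallyReal F] (I J : FractionalIdeal (𝓞 F)⁰ F) : Prop :=
  ∃ a : F, TotPos a ∧ I = FractionalIdeal.spanSingleton (𝓞 F)⁰ a * J

variable (F) in
/-- The different `𝔡` of `F`. -/
def different : Ideal (𝓞 F) := differentIdeal ℤ (𝓞 F)

variable (F) in
/-- `t` is a system of finite ideles whose ideals form a complete set of representatives of the
narrow class group of `F`. -/
def IsNarrowRepSystem [IsTotallyReal F] {N : Type*} (t : N → (FinAdeles F)ˣ) : Prop :=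
  ∀ I : FractionalIdeal (𝓞 F)⁰ F, I ≠ 0 → ∃! ν, NarrowEquiv I (ideleIdeal (t ν))

variable (F) in
/-- The group of narrow ideal class characters: characters of `𝔸ˣ` that are trivial on
`Fˣ · F_ℝ⁺ · ∏ 𝒪_𝔭ˣ`. Continuity is automatic since `F_ℝ⁺ · ∏ 𝒪_𝔭ˣ` is open. -/
def narrowClassCharacters [IsTotallyReal F] : Subgroup ((Adeles F)ˣ →* ℂˣ) where
  carrier := {ψ | (∀ a : Fˣ, ψ (Units.map (algebraMap F (Adeles F)).toMonoidHom a) = 1) ∧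
    ∀ a : (Adeles F)ˣ, (∀ v, 0 < completionEquiv v (a.1.1 v)) →
      (∀ v : HeightOneSpectrum (𝓞 F), Valued.v (a.1.2 v) = 1) → ψ a = 1}
  one_mem' := ⟨fun _ => rfl, fun _ _ _ => rfl⟩
  mul_mem' := fun {a b} ha hb =>
    ⟨fun x => by rw [MonoidHom.mul_apply, ha.1, hb.1, one_mul],
      fun x h₁ h₂ => by rw [MonoidHom.mul_apply, ha.2 x h₁ h₂, hb.2 x h₁ h₂, one_mul]⟩
  inv_mem' := fun {a} ha =>
    ⟨fun x => by rw [MonoidHom.inv_apply, ha.1, inv_one],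
      fun x h₁ h₂ => by rw [MonoidHom.inv_apply, ha.2 x h₁ h₂, inv_one]⟩

/-! ### Adelic Hilbert modular forms of full level -/

variable (F) in
/-- The compact open subgroup `K = K₀(𝔡, 𝒪)` of `GL₂(𝔸_f)`: matrices with entries in
`(𝒪̂, 𝔡⁻¹𝒪̂; 𝔡𝒪̂, 𝒪̂)` and determinant in `𝒪̂ˣ`. -/
def levelK : Set (GL (Fin 2) (FinAdeles F)) :=
  {u | MemIdealHat 1 (u.1 0 0) ∧
    MemIdealHat (different F : FractionalIdeal (𝓞 F)⁰ F)⁻¹ (u.1 0 1) ∧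
    MemIdealHat (different F : FractionalIdeal (𝓞 F)⁰ F) (u.1 1 0) ∧
    MemIdealHat 1 (u.1 1 1) ∧
    ∀ v : HeightOneSpectrum (𝓞 F), Valued.v (u.1.det v) = 1}

/-- The group `ℝˣ · SO₂(ℝ)`. -/
def realCompact : Set (GL (Fin 2) ℝ) :=
  {u | ∃ r : ℝ, r ≠ 0 ∧ ∃ R ∈ Matrix.specialOrthogonalGroup (Fin 2) ℝ, u.1 = r • R}

/-- `j(g, z) = ∏ᵥ (cᵥ zᵥ + dᵥ)`. -/
def autJ (g : InfinitePlace F → GL (Fin 2) ℝ) (z : HalfSpace F) : ℂ :=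
  ∏ v, denom (g v) (z v)

/-- `det(g) ^ s`, where `det(g) = ∏ᵥ det(gᵥ)`; used for `det(gᵥ) > 0`. -/
def detPow (g : InfinitePlace F → GL (Fin 2) ℝ) (s : ℝ) : ℂ :=
  (((∏ v, (g v).1.det) ^ s : ℝ) : ℂ)

variable (F) in
/-- The base point `i = (i, i)`. -/
def basePt : HalfSpace F := fun _ => UpperHalfPlane.I

/-- `det(g)^(-k/2) j(g, i)^k f(xg)`, which computes `f_x(z)` at `z = g i`. -/
def archValue [IsTotallyReal F] (k : ℤ) (f : GL (Fin 2) (Adeles F) → ℂ)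
    (x : GL (Fin 2) (FinAdeles F)) (g : InfinitePlace F → GL (Fin 2) ℝ) : ℂ :=
  detPow g (-(k : ℝ) / 2) * autJ g (basePt F) ^ k * f (adelicGL x g)

/-- Holomorphic functions on the product of upper half planes. -/
def IsHolomorphic (φ : HalfSpace F → ℂ) : Prop :=
  DifferentiableOn ℂ (fun w : InfinitePlace F → ℂ => φ fun v => UpperHalfPlane.ofComplex (w v))
    {w | ∀ v, 0 < (w v).im}

/-- Adelic Hilbert modular forms of full level and parallel weight `k` (the space `𝓜_k`). -/
structure IsModularForm [IsTotallyReal F] (k : ℤ) (f : GL (Fin 2) (Adeles F) → ℂ) : Prop where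
  left_invariant : ∀ (γ : GL (Fin 2) F) (g : GL (Fin 2) (Adeles F)),
    f (Matrix.GeneralLinearGroup.map (algebraMap F (Adeles F)) γ * g) = f g
  right_invariant : ∀ (g : GL (Fin 2) (Adeles F)), ∀ u ∈ levelK F, f (g * adelicGL u 1) = f g
  weight : ∀ (g : GL (Fin 2) (Adeles F)) (u : InfinitePlace F → GL (Fin 2) ℝ),
    (∀ v, u v ∈ realCompact) →
      f (g * adelicGL 1 u) = detPow u ((k : ℝ) / 2) * autJ u (basePt F) ^ (-k) * f g
  holomorphic : ∀ x : GL (Fin 2) (FinAdeles F), ∃ φ : HalfSpace F → ℂ, IsHolomorphic φ ∧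
    ∀ g : InfinitePlace F → GL (Fin 2) ℝ, (∀ v, 0 < (g v).1.det) →
      φ (fun v => g v • basePt F v) = archValue k f x g

/-- The space `𝓜_k(ψ)` of adelic Hilbert modular forms with central character `ψ`. -/
structure IsModularFormWithChar [IsTotallyReal F] (k : ℤ) (ψ : (Adeles F)ˣ →* ℂˣ)
    (f : GL (Fin 2) (Adeles F) → ℂ) : Prop extends IsModularForm k f where
  central : ∀ (a : (Adeles F)ˣ) (g : GL (Fin 2) (Adeles F)),
    f (Matrix.GeneralLinearGroup.scalar (Fin 2) a * g) = (ψ a : ℂ) * f g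

/-! ### Components and Fourier coefficients -/

/-- The real matrix `(y, x; 0, 1)` sending `i` to `z = x + iy`. -/
def toPoint (z : ℍ) : GL (Fin 2) ℝ :=
  Matrix.GeneralLinearGroup.mkOfDetNeZero !![z.im, z.re; 0, 1]
    (by simpa [Matrix.det_fin_two_of] using z.im_pos.ne')

/-- The finite matrix `α_t = diag(t⁻¹, 1)`. -/
def alphaMat (t : (FinAdeles F)ˣ) : GL (Fin 2) (FinAdeles F) where
  val := !![(t⁻¹).1, 0; 0, 1]
  inv := !![t.1, 0; 0, 1]
  val_inv := by
    rw [Matrix.mul_fin_two, Matrix.one_fin_two]; simp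
  inv_val := by
    rw [Matrix.mul_fin_two, Matrix.one_fin_two]; simp

/-- The component `f_ν` on the product of upper half planes attached to the finite idele `t = t_ν`,
a classical Hilbert modular form for `Γ₀(t𝔡, 𝒪)`: it is determined by
`f(α_t g) = (f_ν |_k g)(i)` for archimedean `g` of totally positive determinant. -/
def component [IsTotallyReal F] (k : ℤ) (f : GL (Fin 2) (Adeles F) → ℂ) (t : (FinAdeles F)ˣ) :
    HalfSpace F → ℂ :=
  fun z => archValue k f (alphaMat t) fun v => toPoint (z v)

/-- `q^μ = exp(2πi Tr(μz))`. -/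
def qPow [IsTotallyReal F] (μ : F) (z : HalfSpace F) : ℂ :=
  Complex.exp (2 * Real.pi * Complex.I * ∑ v, (realEmb v μ : ℂ) * (z v : ℂ))

/-- `φ(z) = ∑_{μ ∈ L} a(μ) q^μ`, with (absolute) convergence at every `z`. -/
def IsFourierExpansion [IsTotallyReal F] (φ : HalfSpace F → ℂ) (L : FractionalIdeal (𝓞 F)⁰ F)
    (a : F → ℂ) : Prop :=
  (∀ μ, μ ∉ L → a μ = 0) ∧
    ∀ z, HasSum (fun μ : {μ : F // μ ∈ L} => a μ * qPow (μ : F) z) (φ z)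

open Classical in
/-- The Fourier coefficients of `φ` over the lattice `L` (the expansion is unique if it exists). -/
def fourierCoeff [IsTotallyReal F] (φ : HalfSpace F → ℂ) (L : FractionalIdeal (𝓞 F)⁰ F) : F → ℂ :=
  if h : ∃ a, IsFourierExpansion φ L a then h.choose else 0

/-- The Fourier coefficient `a_ν(μ)` of the component `f_ν`, over the lattice
`((t𝔡)⁻¹)^∨ = t𝒪`, where `t = t_ν`. -/
def compCoeff [IsTotallyReal F] (k : ℤ) (f : GL (Fin 2) (Adeles F) → ℂ) (t : (FinAdeles F)ˣ) :
    F → ℂ :=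
  fourierCoeff (component k f t) (ideleIdeal t)

/-- The factor `N(t) ^ (-k/2)`. -/
def normFactor (k : ℤ) (t : (FinAdeles F)ˣ) : ℂ := ((ideleNorm t ^ (-(k : ℝ) / 2) : ℝ) : ℂ)

/-- The normalized constant term `c_ν(0, f) = N(t_ν)^(-k/2) a_ν(0)`, where `t = t_ν`. -/
def constCoeff [IsTotallyReal F] (k : ℤ) (f : GL (Fin 2) (Adeles F) → ℂ) (t : (FinAdeles F)ˣ) :
    ℂ :=
  normFactor k t * compCoeff k f t 0

open Classical in
/-- The normalized Fourier coefficient `c(𝔪, f) = N(t_ν)^(-k/2) a_ν(μ)`, where `𝔪 = t_ν⁻¹(μ)` with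
`μ ≫ 0` (for `𝔪 ≠ 0`; the choice of `μ` does not matter). -/
def coeff [IsTotallyReal F] {N : Type*} (t : N → (FinAdeles F)ˣ) (k : ℤ)
    (f : GL (Fin 2) (Adeles F) → ℂ) (m : Ideal (𝓞 F)) : ℂ :=
  if h : ∃ p : N × F, TotPos p.2 ∧
      (m : FractionalIdeal (𝓞 F)⁰ F) =
        (ideleIdeal (t p.1))⁻¹ * FractionalIdeal.spanSingleton (𝓞 F)⁰ p.2 then
    normFactor k (t h.choose.1) * compCoeff k f (t h.choose.1) h.choose.2
  else 0

end

end HilbertModular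

/-! The automorphy factors are multiplicative in the weight, so a product of forms is a form and its
components are the products of the components. What remains is to multiply Fourier series: the
coefficient of a product at `μ` is the convolution of the coefficients over `μ = ν + (μ - ν)`. By
the Koecher principle only summands that are zero or totally positive count. The two decompositions
with a zero summand give the products with constant terms; the others form a finite set, to be
enumerated.

Analysis. For a `ℤ^n`-periodic holomorphic function on a tube domain, Cauchy's theorem shows how the
Fourier coefficients vary with the height, and comparing a height with a nearby one gives
exponential decay, hence absolute convergence (`IsPeriodicOnTube.exists_hasSum`). Uniqueness comes
from orthonormality of the characters. A basis of `t𝒪` and its trace dual carry both facts to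
`HalfSpace F`. Rational unipotent matrices provide the periods of a component, and rational diagonal
matrices provide invariance under totally positive units. The latter yields the Koecher principle
(`IsModularForm.compCoeff_eq_zero`) and the independence of `c(𝔪, f)` of the choice of `μ`
(`coeff_eq`).

Arithmetic. On the trivial class the decompositions of `(n)` are the `n = α + (n - α)` in `𝒪` with
both summands totally positive (`coeff_span_mul`). Positivity confines the trace `T` and the norm
`N` of `α` to a short list. If `T² - 4N` is a square it must vanish and `α` is rational. Otherwise,
for `n ≤ 4`, it is `5`, `8` or `12`; inertness of `2` excludes the last two, which occur only for `n
= 4`. The value `5` forces `D = 5` and produces `η` with `η² = 3η - 1`, a totally positive unit,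
from which the correction terms arise. For a prime of norm two, a decomposition `1 = α + (1 - α)`
would need two norms of at least `1/2`, which is impossible. -/

namespace HilbertModular

noncomputable section

/-! ### Fourier series of periodic holomorphic functions on tube domains -/

section Tube

open MeasureTheory UnitAddTorus

/-- The measure on `ℝ / ℤ` is normalised to have total volume one. -/
local instance : MeasureSpace UnitAddCircle := ⟨AddCircle.haarAddCircle⟩

local instance : Measure.IsAddHaarMeasure (volume : Measure UnitAddCircle) :=
  inferInstanceAs (Measure.IsAddHaarMeasure AddCircle.haarAddCircle)

local instance : IsProbabilityMeasure (volume : Measure UnitAddCircle) :=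
  inferInstanceAs (IsProbabilityMeasure AddCircle.haarAddCircle)

variable {ι : Type*}

/-- The point `x + iy` of the complexification of `ℝ^ι`. -/
def tubePoint (x y : ι → ℝ) : ι → ℂ := fun j => (x j : ℂ) + (y j : ℂ) * Complex.I

/-- The projection of `ℝ^ι` onto the torus. -/
def torusProj : (ι → ℝ) → UnitAddTorus ι := Pi.map fun _ => QuotientAddGroup.mk

lemma isOpenQuotientMap_torusProj : IsOpenQuotientMap (torusProj (ι := ι)) :=
  IsOpenQuotientMap.piMap fun _ => QuotientAddGroup.isOpenQuotientMap_mk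

lemma torusProj_add (x x' : ι → ℝ) : torusProj (x + x') = torusProj x + torusProj x' := rfl

lemma exists_int_of_torusProj_eq {x x' : ι → ℝ} (h : torusProj x = torusProj x') :
    ∃ m : ι → ℤ, x = fun j => x' j + m j := by
  have h' : ∀ j, ∃ m : ℤ, x j = x' j + m := by
    intro j
    obtain ⟨m, hm⟩ := QuotientAddGroup.eq.1 (congrFun h j).symm
    refine ⟨m, ?_⟩
    simp only [zsmul_eq_mul, mul_one] at hm
    linarith
  choose m hm using h'
  exact ⟨m, funext hm⟩

lemma mFourier_torusProj [Fintype ι] (m : ι → ℤ) (x : ι → ℝ) :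
    mFourier m (torusProj x) = Complex.exp (2 * Real.pi * Complex.I * ∑ j, (m j : ℂ) * x j) := by
  rw [Finset.mul_sum, Complex.exp_sum]
  refine Finset.prod_congr rfl fun j _ => ?_
  refine (fourier_coe_apply (T := 1)).trans ?_
  congr 1
  push_cast
  ring

/-- Summability of `∏ⱼ g(mⱼ)` over `ℤ^ι`. -/
lemma summable_prod_pi [Fintype ι] {g : ℤ → ℝ} (hg : ∀ n, 0 ≤ g n) (hs : Summable g) :
    Summable fun m : ι → ℤ => ∏ j, g (m j) := by
  classical
  refine summable_of_sum_le (c := ∏ _j : ι, ∑' n, g n)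
    (fun m => Finset.prod_nonneg fun j _ => hg _) fun s => ?_
  let S : ι → Finset ℤ := fun j => s.image fun m => m j
  have hsub : s ⊆ Fintype.piFinset S := fun m hm =>
    Fintype.mem_piFinset.2 fun j => Finset.mem_image_of_mem _ hm
  calc ∑ m ∈ s, ∏ j, g (m j) ≤ ∑ m ∈ Fintype.piFinset S, ∏ j, g (m j) :=
        Finset.sum_le_sum_of_subset_of_nonneg hsub
          fun m _ _ => Finset.prod_nonneg fun j _ => hg _
    _ = ∏ j, ∑ n ∈ S j, g n := (Finset.prod_univ_sum S fun _ n => g n).symm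
    _ ≤ _ := Finset.prod_le_prod (fun j _ => Finset.sum_nonneg fun n _ => hg n)
        fun j _ => hs.sum_le_tsum _ fun n _ => hg n

lemma summable_exp_neg_abs {c : ℝ} (hc : 0 < c) :
    Summable fun n : ℤ => Real.exp (-(c * |(n : ℝ)|)) := by
  have h : Summable fun n : ℕ => Real.exp (-(c * n)) := by
    have := Real.summable_exp_nat_mul_iff.2 (neg_neg_of_pos hc)
    refine this.congr fun n => ?_
    ring_nf
  refine Summable.of_nat_of_neg ?_ ?_ <;> simpa using h

/-- The data of a periodic holomorphic function on the tube domain `ℝ^ι + iU`. -/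
structure IsPeriodicOnTube (U : Set (ι → ℝ)) (Ψ : (ι → ℂ) → ℂ) : Prop where
  isOpen : IsOpen U
  convex : Convex ℝ U
  differentiableOn : DifferentiableOn ℂ Ψ {w | (fun j => (w j).im) ∈ U}
  periodic : ∀ x y : ι → ℝ, y ∈ U → ∀ m : ι → ℤ,
    Ψ (tubePoint (fun j => x j + m j) y) = Ψ (tubePoint x y)

/-- The function on the torus obtained from a periodic function. -/
def torusLift (Ψ : (ι → ℂ) → ℂ) (x : UnitAddTorus ι) (y : ι → ℝ) : ℂ :=
  Ψ (tubePoint (Function.surjInv isOpenQuotientMap_torusProj.surjective x) y)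

variable {U : Set (ι → ℝ)} {Ψ : (ι → ℂ) → ℂ}

lemma IsPeriodicOnTube.torusLift_apply (h : IsPeriodicOnTube U Ψ) (x : ι → ℝ) {y : ι → ℝ}
    (hy : y ∈ U) : torusLift Ψ (torusProj x) y = Ψ (tubePoint x y) := by
  obtain ⟨m, hm⟩ := exists_int_of_torusProj_eq
    (Function.surjInv_eq isOpenQuotientMap_torusProj.surjective (torusProj x))
  rw [torusLift, hm, h.periodic x y hy m]

lemma continuous_tubePoint :
    Continuous fun p : (ι → ℝ) × (ι → ℝ) => tubePoint p.1 p.2 := by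
  unfold tubePoint
  fun_prop

lemma tubePoint_im (x y : ι → ℝ) : (fun j => (tubePoint x y j).im) = y := by
  funext j; simp [tubePoint]

/-- The section in `torusLift` is not continuous, so joint continuity is descended along `torusProj
× id`, which is an open quotient map. -/
lemma IsPeriodicOnTube.continuous_torusLift (h : IsPeriodicOnTube U Ψ) :
    Continuous fun p : UnitAddTorus ι × U => torusLift Ψ p.1 p.2 := by
  have hq : IsOpenQuotientMap (Prod.map (torusProj (ι := ι)) (id : U → U)) :=
    isOpenQuotientMap_torusProj.prodMap IsOpenQuotientMap.id
  rw [hq.isQuotientMap.continuous_iff]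
  have : ((fun p : UnitAddTorus ι × U => torusLift Ψ p.1 p.2) ∘
      Prod.map (torusProj (ι := ι)) (id : U → U)) = fun p => Ψ (tubePoint p.1 p.2) := by
    funext p
    exact h.torusLift_apply p.1 p.2.2
  rw [this]
  refine h.differentiableOn.continuousOn.comp_continuous
    (continuous_tubePoint.comp (continuous_fst.prodMk (continuous_subtype_val.comp continuous_snd)))
    fun p => ?_
  change (fun j => (tubePoint _ _ j).im) ∈ U
  rw [tubePoint_im]
  exact p.2.2

variable [Fintype ι]

/-- The mean value of a periodic holomorphic function over a horizontal torus does not depend on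
the height. -/
theorem IsPeriodicOnTube.integral_torusLift_eq (h : IsPeriodicOnTube U Ψ) {y₀ y₁ : ι → ℝ}
    (hy₀ : y₀ ∈ U) (hy₁ : y₁ ∈ U) :
    ∫ x, torusLift Ψ x y₀ = ∫ x, torusLift Ψ x y₁ := by
  set v : ι → ℝ := y₁ - y₀ with hv
  have hmem : ∀ s ∈ Set.Icc (0 : ℝ) 1, y₀ + s • v ∈ U := fun s hs =>
    h.convex.add_smul_sub_mem hy₀ hy₁ hs
  -- the value at `x + rv + i(y₀ + sv)`
  let G : UnitAddTorus ι → ℝ → ℝ → ℂ := fun x r s =>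
    torusLift Ψ (x + torusProj (r • v)) (y₀ + s • v)
  have hGcont : Continuous fun p : UnitAddTorus ι × ℝ × Set.Icc (0 : ℝ) 1 =>
      G p.1 p.2.1 p.2.2 := by
    refine h.continuous_torusLift.comp (f := fun p : UnitAddTorus ι × ℝ × Set.Icc (0 : ℝ) 1 =>
      (p.1 + torusProj (p.2.1 • v), (⟨y₀ + (p.2.2 : ℝ) • v, hmem _ p.2.2.2⟩ : U))) ?_
    refine Continuous.prodMk ?_ ?_
    · refine continuous_fst.add (isOpenQuotientMap_torusProj.continuous.comp ?_)
      fun_prop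
    · refine Continuous.subtype_mk ?_ _
      fun_prop
  -- clamp the height to make everything globally continuous
  let cl : ℝ → Set.Icc (0 : ℝ) 1 := Set.projIcc 0 1 zero_le_one
  have hcl : ∀ s ∈ Set.uIcc (0 : ℝ) 1, ((cl s : Set.Icc (0 : ℝ) 1) : ℝ) = s := fun s hs => by
    rw [Set.uIcc_of_le zero_le_one] at hs
    exact congrArg Subtype.val (Set.projIcc_of_mem zero_le_one hs)
  have hH : Continuous fun p : UnitAddTorus ι × ℝ => G p.1 p.2 0 :=
    hGcont.comp (f := fun p : UnitAddTorus ι × ℝ => (p.1, p.2, (⟨0, by simp⟩ : Set.Icc (0 : ℝ) 1)))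
      (by fun_prop)
  have hH1 : Continuous fun p : UnitAddTorus ι × ℝ => G p.1 p.2 1 :=
    hGcont.comp (f := fun p : UnitAddTorus ι × ℝ => (p.1, p.2, (⟨1, by simp⟩ : Set.Icc (0 : ℝ) 1)))
      (by fun_prop)
  have hV : ∀ r : ℝ, Continuous fun p : UnitAddTorus ι × ℝ => G p.1 r (cl p.2) := fun r =>
    hGcont.comp (f := fun p : UnitAddTorus ι × ℝ => (p.1, r, cl p.2))
      (continuous_fst.prodMk (continuous_const.prodMk (continuous_projIcc.comp continuous_snd)))
  have hfub : ∀ g : UnitAddTorus ι → ℝ → ℂ, Continuous (fun p : UnitAddTorus ι × ℝ => g p.1 p.2) →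
      ∫ x, (∫ r in (0 : ℝ)..1, g x r) = ∫ r in (0 : ℝ)..1, ∫ x, g x r := by
    intro g hg
    refine (intervalIntegral_integral_swap (f := fun r x => g x r) ?_).symm
    have hg' : Continuous (Function.uncurry fun (r : ℝ) (x : UnitAddTorus ι) => g x r) :=
      hg.comp continuous_swap
    have : ((volume : Measure ℝ).restrict (Set.uIoc 0 1)).prod (volume : Measure (UnitAddTorus ι))
        = (volume.prod volume).restrict (Set.uIoc (0 : ℝ) 1 ×ˢ Set.univ) := by
      rw [← Measure.prod_restrict, Measure.restrict_univ]
    rw [this]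
    exact (hg'.continuousOn.integrableOn_compact
      ((isCompact_uIcc (a := (0 : ℝ)) (b := 1)).prod isCompact_univ)).mono_set
      (Set.prod_mono Set.uIoc_subset_uIcc le_rfl)
  have hint : ∀ g : UnitAddTorus ι → ℝ → ℂ, Continuous (fun p : UnitAddTorus ι × ℝ => g p.1 p.2) →
      Integrable fun x => ∫ r in (0 : ℝ)..1, g x r := by
    intro g hg
    have : Continuous fun x => ∫ r in (0 : ℝ)..1, g x r :=
      intervalIntegral.continuous_parametric_intervalIntegral_of_continuous' hg 0 1
    exact this.integrable_of_hasCompactSupport (HasCompactSupport.of_compactSpace _)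
  -- translation invariance
  have htr : ∀ r s : ℝ, ∫ x, G x r s = ∫ x, torusLift Ψ x (y₀ + s • v) := fun r s =>
    integral_add_right_eq_self (fun x => torusLift Ψ x (y₀ + s • v)) (torusProj (r • v))
  -- Cauchy's theorem on the unit square
  have hcauchy : ∀ x : UnitAddTorus ι,
      (((∫ r in (0 : ℝ)..1, G x r 0) - ∫ r in (0 : ℝ)..1, G x r 1) +
        Complex.I • ∫ s in (0 : ℝ)..1, G x 1 (cl s)) -
        Complex.I • ∫ s in (0 : ℝ)..1, G x 0 (cl s) = 0 := by
    intro x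
    obtain ⟨x, rfl⟩ := isOpenQuotientMap_torusProj.surjective x
    let g : ℂ → ℂ := fun ζ => Ψ fun j => tubePoint x y₀ j + ζ * v j
    have hpt : ∀ r s : ℝ, (fun j => tubePoint x y₀ j + ((r : ℂ) + (s : ℂ) * Complex.I) * v j) =
        tubePoint (x + r • v) (y₀ + s • v) := by
      intro r s
      funext j
      simp only [tubePoint, Pi.add_apply, Pi.smul_apply, smul_eq_mul]
      push_cast
      ring
    have hgG : ∀ r s : ℝ, s ∈ Set.Icc (0 : ℝ) 1 →
        g ((r : ℂ) + (s : ℂ) * Complex.I) = G (torusProj x) r s := by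
      intro r s hs
      change _ = torusLift Ψ _ _
      rw [← torusProj_add, h.torusLift_apply _ (hmem s hs), ← hpt]
    have hd : DifferentiableOn ℂ g
        (Set.uIcc (0 : ℂ).re (1 + Complex.I : ℂ).re ×ℂ
          Set.uIcc (0 : ℂ).im (1 + Complex.I : ℂ).im) := by
      refine h.differentiableOn.comp (f := fun ζ : ℂ => fun j => tubePoint x y₀ j + ζ * v j) ?_ ?_
      · fun_prop
      · intro ζ hζ
        have hζ2 : ζ.im ∈ Set.Icc (0 : ℝ) 1 := by
          have := hζ.2
          simpa using this
        have := hpt ζ.re ζ.im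
        rw [Complex.re_add_im] at this
        change (fun j => (tubePoint x y₀ j + ζ * v j).im) ∈ U
        have h2 := tubePoint_im (x + ζ.re • v) (y₀ + ζ.im • v)
        rw [← this] at h2
        rw [h2]
        exact hmem _ hζ2
    have := Complex.integral_boundary_rect_eq_zero_of_differentiableOn g 0 (1 + Complex.I) hd
    simp only [Complex.zero_re, Complex.zero_im, Complex.add_re, Complex.one_re, Complex.I_re,
      add_zero, Complex.add_im, Complex.one_im, Complex.I_im, zero_add] at this
    rw [← this]
    have e1 : ∀ r : ℝ, g ((r : ℂ) + ((0 : ℝ) : ℂ) * Complex.I) = G (torusProj x) r 0 :=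
      fun r => hgG r 0 (by simp)
    have e2 : ∀ r : ℝ, g ((r : ℂ) + ((1 : ℝ) : ℂ) * Complex.I) = G (torusProj x) r 1 :=
      fun r => hgG r 1 (by simp)
    have e3 : ∀ r : ℝ, (∫ s in (0 : ℝ)..1, G (torusProj x) r (cl s)) =
        ∫ s in (0 : ℝ)..1, g ((r : ℂ) + (s : ℂ) * Complex.I) := fun r =>
      intervalIntegral.integral_congr fun s hs => by
        rw [hcl s hs, hgG r s (by rwa [Set.uIcc_of_le zero_le_one] at hs)]
    rw [e3, e3]
    simp only [e1, e2]
  -- For a single `x` the vertical sides of the square do not cancel, since `v` need not be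
  -- integral. Averaged over the torus they do, by translation invariance, and the horizontal sides
  -- become the means at heights `y₀` and `y₁`.
  have htot : ∫ x : UnitAddTorus ι, ((((∫ r in (0 : ℝ)..1, G x r 0) - ∫ r in (0 : ℝ)..1, G x r 1) +
        Complex.I • ∫ s in (0 : ℝ)..1, G x 1 (cl s)) -
        Complex.I • ∫ s in (0 : ℝ)..1, G x 0 (cl s)) = 0 := by
    simp only [hcauchy, integral_zero]
  rw [integral_sub, integral_add, integral_sub, integral_smul, integral_smul,
    hfub _ hH, hfub _ hH1, hfub (fun x s => G x 1 (cl s)) (hV 1),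
    hfub (fun x s => G x 0 (cl s)) (hV 0)] at htot
  · simp only [htr] at htot
    rw [add_sub_cancel_right, sub_eq_zero] at htot
    simpa [hv] using htot
  · exact hint _ hH
  · exact hint _ hH1
  · exact (hint _ hH).sub (hint _ hH1)
  · exact (hint (fun x s => G x 1 (cl s)) (hV 1)).smul Complex.I
  · exact ((hint _ hH).sub (hint _ hH1)).add ((hint (fun x s => G x 1 (cl s)) (hV 1)).smul Complex.I)
  · exact (hint (fun x s => G x 0 (cl s)) (hV 0)).smul Complex.I

/-- The exponential `e(∑ mⱼwⱼ)`. -/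
def expSum (m : ι → ℤ) (w : ι → ℂ) : ℂ :=
  Complex.exp (2 * Real.pi * Complex.I * ∑ j, (m j : ℂ) * w j)

lemma expSum_tubePoint (m : ι → ℤ) (x y : ι → ℝ) :
    expSum m (tubePoint x y) =
      mFourier m (torusProj x) * Real.exp (-(2 * Real.pi * ∑ j, (m j : ℝ) * y j)) := by
  rw [mFourier_torusProj, expSum, Complex.ofReal_exp, ← Complex.exp_add]
  congr 1
  simp only [tubePoint, mul_add, Finset.sum_add_distrib, add_right_inj]
  push_cast
  rw [Finset.mul_sum, Finset.mul_sum, ← Finset.sum_neg_distrib]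
  refine Finset.sum_congr rfl fun j _ => ?_
  linear_combination (2 * Real.pi * (m j : ℂ) * (y j : ℂ)) * Complex.I_mul_I

/-- Multiplication by `expSum (-m)` moves the `m`-th Fourier coefficient to index zero, where it is
a mean value. -/
lemma IsPeriodicOnTube.mul_expSum (h : IsPeriodicOnTube U Ψ) (m : ι → ℤ) :
    IsPeriodicOnTube U fun w => expSum m w * Ψ w where
  isOpen := h.isOpen
  convex := h.convex
  differentiableOn := by
    refine DifferentiableOn.mul (Differentiable.differentiableOn ?_) h.differentiableOn
    unfold expSum
    fun_prop
  periodic x y hy n := by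
    have : torusProj (fun j => x j + (n j : ℝ)) = torusProj x := by
      funext j
      refine QuotientAddGroup.eq.2 ⟨-n j, ?_⟩
      simp
    rw [h.periodic x y hy n, expSum_tubePoint, expSum_tubePoint, this]

/-- The Fourier coefficients at all heights come from a single family. -/
lemma IsPeriodicOnTube.exists_mFourierCoeff_eq (h : IsPeriodicOnTube U Ψ) :
    ∃ a : (ι → ℤ) → ℂ, ∀ y ∈ U, ∀ m, mFourierCoeff (fun x => torusLift Ψ x y) m =
      a m * Real.exp (-(2 * Real.pi * ∑ j, (m j : ℝ) * y j)) := by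
  rcases U.eq_empty_or_nonempty with rfl | ⟨y₀, hy₀⟩
  · exact ⟨0, by simp⟩
  -- The mean of `e(-m·w)Ψ` is `e^{2π m·y}` times the `m`-th coefficient at height `y`, and the mean
  -- is independent of `y`.
  have key : ∀ y ∈ U, ∀ m, ∫ x, torusLift (fun w => expSum (-m) w * Ψ w) x y =
      Real.exp (2 * Real.pi * ∑ j, (m j : ℝ) * y j) *
        mFourierCoeff (fun x => torusLift Ψ x y) m := by
    intro y hy m
    rw [mFourierCoeff, ← integral_const_mul]
    refine integral_congr_ae (Filter.Eventually.of_forall fun x => ?_)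
    obtain ⟨x, rfl⟩ := isOpenQuotientMap_torusProj.surjective x
    beta_reduce
    rw [(h.mul_expSum (-m)).torusLift_apply _ hy, h.torusLift_apply _ hy, expSum_tubePoint,
      smul_eq_mul]
    have : -(2 * Real.pi * ∑ j, ((-m) j : ℝ) * y j) = 2 * Real.pi * ∑ j, (m j : ℝ) * y j := by
      simp
    rw [this]
    ring
  refine ⟨fun m => ∫ x, torusLift (fun w => expSum (-m) w * Ψ w) x y₀, fun y hy m => ?_⟩
  beta_reduce
  rw [(h.mul_expSum (-m)).integral_torusLift_eq hy₀ hy, key y hy m, mul_right_comm,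
    ← Complex.ofReal_mul, ← Real.exp_add, add_neg_cancel, Real.exp_zero, Complex.ofReal_one,
    one_mul]

lemma norm_mFourierCoeff_le {g : UnitAddTorus ι → ℂ} {M : ℝ} (hg : ∀ x, ‖g x‖ ≤ M) (m : ι → ℤ) :
    ‖mFourierCoeff g m‖ ≤ M := by
  rw [mFourierCoeff]
  refine (norm_integral_le_of_norm_le_const (C := M) (Filter.Eventually.of_forall fun x => ?_)).trans
    (by simp)
  obtain ⟨x, rfl⟩ := isOpenQuotientMap_torusProj.surjective x
  rw [norm_smul, mFourier_torusProj, Complex.norm_exp]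
  have : (2 * Real.pi * Complex.I * ∑ j, ((-m) j : ℂ) * (x j : ℂ)).re = 0 := by
    simp [← Complex.ofReal_intCast, ← Complex.ofReal_mul, ← Complex.ofReal_sum]
  rw [this, Real.exp_zero, one_mul]
  exact hg _

/-- A periodic holomorphic function on a tube domain has an absolutely convergent Fourier
expansion. -/
theorem IsPeriodicOnTube.exists_hasSum (h : IsPeriodicOnTube U Ψ) :
    ∃ a : (ι → ℤ) → ℂ, ∀ x y : ι → ℝ, y ∈ U →
      HasSum (fun m => a m * expSum m (tubePoint x y)) (Ψ (tubePoint x y)) := by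
  obtain ⟨a, ha⟩ := h.exists_mFourierCoeff_eq
  refine ⟨a, fun x y hy => ?_⟩
  obtain ⟨δ, hδ, hball⟩ := (Metric.nhds_basis_closedBall.mem_iff).1 (h.isOpen.mem_nhds hy)
  have hcont : Continuous fun x => torusLift Ψ x y :=
    h.continuous_torusLift.comp (f := fun x => (x, (⟨y, hy⟩ : U))) (by fun_prop)
  -- a uniform bound over a neighbourhood of the height
  obtain ⟨M, hM⟩ : ∃ M, ∀ x, ∀ y' ∈ Metric.closedBall y δ, ‖torusLift Ψ x y'‖ ≤ M := by
    have hK : IsCompact (Metric.closedBall y δ) := isCompact_closedBall y δ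
    have hc : Continuous fun p : UnitAddTorus ι × Metric.closedBall y δ =>
        torusLift Ψ p.1 (p.2 : ι → ℝ) :=
      h.continuous_torusLift.comp (f := fun p : UnitAddTorus ι × Metric.closedBall y δ =>
        (p.1, (⟨p.2, hball p.2.2⟩ : U))) (by fun_prop)
    have : CompactSpace (Metric.closedBall y δ) := isCompact_iff_compactSpace.1 hK
    obtain ⟨M, hM⟩ := (isCompact_range hc).isBounded.exists_norm_le
    exact ⟨M, fun x y' hy' => hM _ ⟨(x, ⟨y', hy'⟩), rfl⟩⟩
  have hsum : Summable (mFourierCoeff fun x => torusLift Ψ x y) := by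
    have hg := summable_prod_pi (ι := ι) (g := fun n : ℤ => Real.exp (-(2 * Real.pi * δ * |(n : ℝ)|)))
      (fun n => (Real.exp_pos _).le) (summable_exp_neg_abs (by positivity))
    refine Summable.of_norm_bounded (hg.mul_left M) fun m => ?_
    -- Moving the height by `δ` against the signs of `m` increases `e^{-2π m·y}` by the factor
    -- `e^{2πδ∑|mⱼ|}`. The coefficient at `y'` is still at most `M`, so the one at `y` is at most `M
    -- e^{-2πδ∑|mⱼ|}`.
    let y' : ι → ℝ := fun j => y j - δ * SignType.sign (m j : ℝ)
    have hy' : y' ∈ Metric.closedBall y δ := by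
      rw [Metric.mem_closedBall, dist_pi_le_iff hδ.le]
      intro j
      rw [Real.dist_eq]
      simp only [y', sub_sub_cancel_left, abs_neg, abs_mul, abs_of_pos hδ]
      refine mul_le_of_le_one_right hδ.le ?_
      rcases lt_trichotomy (m j : ℝ) 0 with hj | hj | hj <;> simp [hj]
    have e : mFourierCoeff (fun x => torusLift Ψ x y) m =
        mFourierCoeff (fun x => torusLift Ψ x y') m *
          (∏ j, Real.exp (-(2 * Real.pi * δ * |(m j : ℝ)|)) : ℝ) := by
      rw [ha y hy, ha y' (hball hy'), mul_assoc (a m), ← Complex.ofReal_mul, ← Real.exp_sum,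
        ← Real.exp_add]
      congr 3
      rw [Finset.mul_sum, Finset.mul_sum, ← Finset.sum_neg_distrib, ← Finset.sum_neg_distrib,
        ← Finset.sum_add_distrib]
      refine Finset.sum_congr rfl fun j _ => ?_
      have : (m j : ℝ) * SignType.sign (m j : ℝ) = |(m j : ℝ)| := self_mul_sign _
      rw [← this]
      ring
    rw [e, norm_mul, Complex.norm_real, Real.norm_eq_abs,
      abs_of_pos (Finset.prod_pos fun j _ => Real.exp_pos _)]
    exact mul_le_mul_of_nonneg_right (norm_mFourierCoeff_le (fun x => hM x y' hy') m)
      (Finset.prod_nonneg fun j _ => (Real.exp_pos _).le)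
  have := hasSum_mFourier_series_apply_of_summable (f := ⟨fun x => torusLift Ψ x y, hcont⟩) hsum
    (torusProj x)
  rw [ContinuousMap.coe_mk, h.torusLift_apply x hy] at this
  refine this.congr_fun fun m => ?_
  rw [ha y hy, smul_eq_mul, expSum_tubePoint]
  ring

/-- Uniqueness of absolutely convergent Fourier expansions. -/
theorem fourierSeries_eq_zero {c : (ι → ℤ) → ℂ}
    (hc : ∀ x : ι → ℝ, HasSum (fun m => c m * mFourier m (torusProj x)) 0) : c = 0 := by
  -- At `x = 0` every character is `1`, so the hypothesis already contains the summability of `c`.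
  have hsum : Summable fun m => ‖c m‖ := by
    have := (hc 0).summable
    have h1 : ∀ m : ι → ℤ, mFourier m (torusProj (0 : ι → ℝ)) = 1 := fun m => by
      rw [mFourier_torusProj]; simp
    simp only [h1, mul_one] at this
    exact this.norm
  have hS : Summable fun m => c m • (mFourier m : C(UnitAddTorus ι, ℂ)) := by
    refine Summable.of_norm ?_
    simpa only [norm_smul, mFourier_norm, mul_one] using hsum
  have hzero : ∑' m, c m • (mFourier m : C(UnitAddTorus ι, ℂ)) = 0 := by
    ext x
    obtain ⟨x, rfl⟩ := isOpenQuotientMap_torusProj.surjective x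
    have := (ContinuousMap.evalCLM ℂ (torusProj x)).hasSum hS.hasSum
    exact this.unique (hc x)
  have hH := hS.hasSum
  rw [hzero] at hH
  -- The series converges to zero uniformly, hence in `L²`, where pairing with the orthonormal
  -- character `n` isolates `c n`.
  have hL := (ContinuousMap.toLp (E := ℂ) 2 (volume : Measure (UnitAddTorus ι)) ℂ).hasSum hH
  rw [map_zero] at hL
  funext n
  have hI := (innerSL ℂ (mFourierLp 2 n)).hasSum hL
  have hone : HasSum (fun m => (innerSL ℂ (mFourierLp 2 n))
      (ContinuousMap.toLp (E := ℂ) 2 (volume : Measure (UnitAddTorus ι)) ℂ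
        (c m • (mFourier m : C(UnitAddTorus ι, ℂ))))) (c n) := by
    have horth := orthonormal_iff_ite.1 (orthonormal_mFourier (d := ι))
    convert hasSum_ite_eq n (c n) using 2 with m
    rw [map_smul, map_smul, innerSL_apply_apply, horth n m, smul_eq_mul]
    by_cases hmn : m = n
    · subst hmn; simp
    · simp [hmn, Ne.symm hmn]
  simpa using hone.unique hI

end Tube

end

end HilbertModular

namespace HilbertModular

noncomputable section

/-! ### Real embeddings, trace and norm -/

section Embeddings

variable {F : Type*} [Field F] [IsTotallyReal F]

lemma coe_realEmb (v : InfinitePlace F) (x : F) : (realEmb v x : ℂ) = v.embedding x :=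
  InfinitePlace.embedding_of_isReal_apply _ _

lemma abs_realEmb (v : InfinitePlace F) (x : F) : |realEmb v x| = v x := by
  rw [← InfinitePlace.norm_embedding_eq, ← coe_realEmb, Complex.norm_real, Real.norm_eq_abs]

lemma realEmb_ne_zero (v : InfinitePlace F) {x : F} (hx : x ≠ 0) : realEmb v x ≠ 0 :=
  (map_ne_zero _).2 hx

variable [NumberField F]

variable (F) in
/-- The infinite places of a totally real field correspond to its complex embeddings. -/
def placeEquiv : InfinitePlace F ≃ (F →ₐ[ℚ] ℂ) :=
  (Equiv.mk (fun v => v.embedding) InfinitePlace.mk (fun v => InfinitePlace.mk_embedding v)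
    fun φ => InfinitePlace.embedding_mk_eq_of_isReal
      (IsTotallyReal.complexEmbedding_isReal φ)).trans (RingHom.equivRatAlgHom F ℂ)

lemma placeEquiv_apply (v : InfinitePlace F) (x : F) : placeEquiv F v x = realEmb v x :=
  (coe_realEmb v x).symm

/-- Over a totally real field each infinite place carries exactly one complex embedding, so the sum
over embeddings is a sum over places. -/
lemma sum_realEmb (x : F) : ∑ v, realEmb v x = (Algebra.trace ℚ F x : ℝ) := by
  have h := trace_eq_sum_embeddings ℂ (K := ℚ) (x := x)
  rw [← (placeEquiv F).sum_comp] at h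
  simp only [placeEquiv_apply] at h
  have h2 : ((Algebra.trace ℚ F x : ℝ) : ℂ) = ((∑ v, realEmb v x : ℝ) : ℂ) := by
    rw [Complex.ofReal_sum, ← h]; simp
  exact_mod_cast h2.symm

lemma prod_realEmb (x : F) : ∏ v, realEmb v x = (Algebra.norm ℚ x : ℝ) := by
  have h := Algebra.norm_eq_prod_embeddings ℚ ℂ x
  rw [← (placeEquiv F).prod_comp] at h
  simp only [placeEquiv_apply] at h
  have h2 : ((Algebra.norm ℚ x : ℝ) : ℂ) = ((∏ v, realEmb v x : ℝ) : ℂ) := by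
    rw [Complex.ofReal_prod, ← h]; simp
  exact_mod_cast h2.symm

variable (F) in
lemma card_infinitePlace : Fintype.card (InfinitePlace F) = Module.finrank ℚ F := by
  rw [Fintype.card_congr (placeEquiv F), AlgHom.card]

/-- For a rational basis and its trace dual, the matrices of real embeddings are inverse to each
other. -/
lemma exists_dual_basis {ι : Type*} [Fintype ι] [DecidableEq ι]
    [DecidableEq (InfinitePlace F)] (d : Module.Basis ι ℚ F) :
    ∃ b : Module.Basis ι ℚ F, (∀ i j, Algebra.trace ℚ F (d i * b j) = if i = j then 1 else 0) ∧
      (∀ i j, ∑ v, realEmb v (d i) * realEmb v (b j) = if i = j then 1 else 0) ∧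
      ∀ v w, ∑ j, realEmb v (b j) * realEmb w (d j) = if v = w then 1 else 0 := by
  let b := (Algebra.traceForm ℚ F).dualBasis (traceForm_nondegenerate ℚ F) d
  have htr : ∀ i j, Algebra.trace ℚ F (d i * b j) = if i = j then 1 else 0 := by
    intro i j
    have := LinearMap.BilinForm.apply_dualBasis_left
      (traceForm_nondegenerate ℚ F) d j i
    rw [Algebra.traceForm_apply, mul_comm] at this
    exact this
  have h1 : ∀ i j, ∑ v, realEmb v (d i) * realEmb v (b j) = if i = j then 1 else 0 := by
    intro i j
    simp only [← map_mul]
    rw [sum_realEmb, htr]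
    split_ifs <;> simp
  refine ⟨b, htr, h1, fun v w => ?_⟩
  let A : Matrix ι (InfinitePlace F) ℝ := fun i v => realEmb v (d i)
  let B : Matrix (InfinitePlace F) ι ℝ := fun v j => realEmb v (b j)
  have hAB : A * B = 1 := by
    ext i j
    rw [Matrix.mul_apply, Matrix.one_apply]
    exact h1 i j
  -- The two index types differ but have equal cardinality, so a one-sided inverse is two-sided.
  have hcard : Fintype.card ι = Fintype.card (InfinitePlace F) := by
    rw [card_infinitePlace, Module.finrank_eq_card_basis d]
  have hBA := (Matrix.mul_eq_one_comm_of_card_eq ι (InfinitePlace F) ℝ hcard).1 hAB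
  have := congrFun (congrFun hBA v) w
  rw [Matrix.mul_apply, Matrix.one_apply] at this
  exact this

end Embeddings

/-! ### Fourier expansions over a fractional ideal -/

section Expansion

open UnitAddTorus

variable {F : Type*} [Field F] [NumberField F]

variable {L : FractionalIdeal (𝓞 F)⁰ F}

/-- An integral basis of a nonzero fractional ideal. -/
lemma exists_lattice_basis (hL : L ≠ 0) :
    ∃ (n : ℕ) (d : Module.Basis (Fin n) ℚ F) (e : (Fin n → ℤ) ≃ {μ : F // μ ∈ L}),
      ∀ m, (e m : F) = ∑ j, (m j : F) * d j := by
  obtain ⟨I, rfl⟩ : ∃ I : (FractionalIdeal (𝓞 F)⁰ F)ˣ, L = I := ⟨Units.mk0 L hL, rfl⟩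
  let ε := Fintype.equivFin (Module.Free.ChooseBasisIndex ℤ I)
  refine ⟨_, (basisOfFractionalIdeal F I).reindex ε,
    ((fractionalIdealBasis F (I : FractionalIdeal (𝓞 F)⁰ F)).reindex ε).equivFun.symm.toEquiv,
    fun m => ?_⟩
  let M : Submodule (𝓞 F) F := (I : FractionalIdeal (𝓞 F)⁰ F)
  have : ((((fractionalIdealBasis F (I : FractionalIdeal (𝓞 F)⁰ F)).reindex ε).equivFun.symm m :
      M) : F) = ((∑ j, m j • fractionalIdealBasis F (I : FractionalIdeal (𝓞 F)⁰ F) (ε.symm j) :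
        M) : F) := by
    refine congrArg Subtype.val ((Module.Basis.equivFun_symm_apply _ _).trans ?_)
    simp only [Module.Basis.reindex_apply]
  refine this.trans ((map_sum M.subtype _ _).trans ?_)
  refine Finset.sum_congr rfl fun j _ => ?_
  rw [Module.Basis.reindex_apply, basisOfFractionalIdeal_apply]
  refine (map_zsmul M.subtype _ _).trans ?_
  rw [zsmul_eq_mul]
  rfl

variable [IsTotallyReal F]

/-- Translation of the product of upper half planes by an element of the field. -/
def translate (b : F) (z : HalfSpace F) : HalfSpace F := fun v => realEmb v b +ᵥ z v

/-- Inverts the change between lattice coordinates and the coordinates at the infinite places; it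
serves in both directions, once for each of the two orthogonality relations of dual bases. -/
lemma sum_mul_sum_eq {α β : Type*} [Fintype α] [Fintype β] [DecidableEq α] {M : α → β → ℝ}
    {N : α → β → ℝ} (h : ∀ i j, ∑ k, M i k * N j k = if i = j then 1 else 0) (z : α → ℂ) (i : α) :
    ∑ k, (∑ j, (N j k : ℂ) * z j) * (M i k : ℂ) = z i := by
  simp only [Finset.sum_mul]
  rw [Finset.sum_comm]
  calc ∑ j, ∑ k, (N j k : ℂ) * z j * (M i k : ℂ)
      = ∑ j, ((∑ k, M i k * N j k : ℝ) : ℂ) * z j := by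
        refine Finset.sum_congr rfl fun j _ => ?_
        push_cast
        rw [Finset.sum_mul]
        exact Finset.sum_congr rfl fun k _ => by ring
    _ = z i := by simp [h, apply_ite (Complex.ofReal)]

lemma qPow_sum {ι : Type*} [Fintype ι] (d : ι → F) (m : ι → ℤ) (z : HalfSpace F) :
    qPow (∑ j, (m j : F) * d j) z =
      expSum m fun j => ∑ v, (realEmb v (d j) : ℂ) * z v := by
  rw [qPow, expSum]
  congr 2
  simp only [map_sum, map_mul, map_intCast, Complex.ofReal_sum,
    Complex.ofReal_mul, Complex.ofReal_intCast, Finset.sum_mul, Finset.mul_sum]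
  rw [Finset.sum_comm]
  refine Finset.sum_congr rfl fun j _ => Finset.sum_congr rfl fun v _ => by ring

/-- A holomorphic function that is periodic with respect to the dual lattice of `L` has an
absolutely convergent Fourier expansion over `L`. -/
theorem exists_isFourierExpansion (hL : L ≠ 0) {φ : HalfSpace F → ℂ} (hφ : IsHolomorphic φ)
    (hper : ∀ b : F, (∀ a ∈ L, ∃ n : ℤ, Algebra.trace ℚ F (a * b) = n) →
      ∀ z, φ (translate b z) = φ z) :
    ∃ a, IsFourierExpansion φ L a := by
  classical
  obtain ⟨n, d, e, he⟩ := exists_lattice_basis hL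
  obtain ⟨b, htr, h1, h2⟩ := exists_dual_basis d
  -- Coordinates along the dual basis `b`: in them `q^μ` for `μ = ∑ mⱼdⱼ` is the plain character
  -- `e(m·w)`, and an integral shift of `w` is a translation by the dual lattice of `L`.
  let T : (Fin n → ℂ) → InfinitePlace F → ℂ := fun w v =>
    ∑ j, w j * realEmb v (b j)
  let Ψ : (Fin n → ℂ) → ℂ := fun w => φ fun v => ofComplex (T w v)
  let U : Set (Fin n → ℝ) := {y | ∀ v, 0 < ∑ j, y j * realEmb v (b j)}
  have hT_im : ∀ w v, (T w v).im = ∑ j, (w j).im * realEmb v (b j) := by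
    intro w v
    simp [T, Complex.im_sum]
  have hΨ : IsPeriodicOnTube U Ψ :=
    { isOpen := by
        simp only [U, Set.ofPred_forall]
        exact isOpen_iInter_of_finite fun v => isOpen_lt continuous_const (by fun_prop)
      convex := by
        intro x hx y hy s t hs ht hst v
        have e : ∑ j, (s • x + t • y) j * realEmb v (b j) =
            s * ∑ j, x j * realEmb v (b j) + t * ∑ j, y j * realEmb v (b j) := by
          rw [Finset.mul_sum, Finset.mul_sum, ← Finset.sum_add_distrib]
          refine Finset.sum_congr rfl fun j _ => ?_
          simp only [Pi.add_apply, Pi.smul_apply, smul_eq_mul]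
          ring
        rw [e]
        rcases hs.eq_or_lt with rfl | hs
        · rw [zero_add] at hst
          subst hst
          simpa using hy v
        · exact add_pos_of_pos_of_nonneg (mul_pos hs (hx v)) (mul_nonneg ht (hy v).le)
      differentiableOn := by
        refine DifferentiableOn.comp (g := fun w : InfinitePlace F → ℂ =>
          φ fun v => ofComplex (w v)) (f := T) hφ ?_ ?_
        · exact (by fun_prop : Differentiable ℂ T).differentiableOn
        · intro w hw v
          rw [hT_im]
          exact hw v
      periodic := by
        intro x y hy m
        let β : F := ∑ j, (m j : F) * b j
        have hβ : ∀ a ∈ L, ∃ n : ℤ, Algebra.trace ℚ F (a * β) = n := by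
          intro a ha
          obtain ⟨k, hn⟩ := e.surjective ⟨a, ha⟩
          have ha' : a = ∑ j, (k j : F) * d j := by
            rw [← he, hn]
          refine ⟨∑ i, k i * m i, ?_⟩
          rw [ha', Finset.sum_mul_sum, map_sum]
          push_cast
          refine Finset.sum_congr rfl fun i _ => ?_
          rw [map_sum]
          calc ∑ j, Algebra.trace ℚ F ((k i : F) * d i * ((m j : F) * b j))
              = ∑ j, (k i : ℚ) * m j * (if i = j then 1 else 0) := by
                refine Finset.sum_congr rfl fun j _ => ?_
                rw [← htr i j, ← smul_eq_mul ((k i : ℚ) * m j), ← map_smul]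
                congr 1
                rw [Algebra.smul_def, map_mul, map_intCast, map_intCast]
                ring
            _ = (k i : ℚ) * m i := by simp
        have him : ∀ v, 0 < (T (tubePoint x y) v).im := fun v => by
          rw [hT_im]
          have := hy v
          simpa [tubePoint] using this
        have hT : ∀ v, T (tubePoint (fun j => x j + m j) y) v =
            (realEmb v β : ℂ) + T (tubePoint x y) v := by
          intro v
          simp only [T, β, tubePoint, map_sum, map_mul, map_intCast, Complex.ofReal_sum]
          rw [← Finset.sum_add_distrib]
          refine Finset.sum_congr rfl fun j _ => ?_
          push_cast
          ring
        change φ _ = φ _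
        rw [← hper β hβ fun v => ofComplex (T (tubePoint x y) v)]
        congr 1
        funext v
        apply UpperHalfPlane.ext
        have him' : 0 < ((realEmb v β : ℂ) + T (tubePoint x y) v).im := by
          simpa using him v
        change ((ofComplex (T (tubePoint (fun j => x j + m j) y) v) : ℍ) : ℂ) = _
        rw [translate, coe_vadd, ofComplex_apply_of_im_pos (him v), hT v,
          ofComplex_apply_of_im_pos him'] }
  obtain ⟨a, ha⟩ := hΨ.exists_hasSum
  refine ⟨fun μ => if h : μ ∈ L then a (e.symm ⟨μ, h⟩) else 0,
    fun μ hμ => dif_neg hμ, fun z => ?_⟩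
  rw [← e.hasSum_iff]
  let W : Fin n → ℂ := fun j => ∑ v, (realEmb v (d j) : ℂ) * z v
  let x : Fin n → ℝ := fun j => (W j).re
  let y : Fin n → ℝ := fun j => (W j).im
  have hW : tubePoint x y = W := funext fun j => Complex.re_add_im _
  have hTW : ∀ v, T W v = z v := fun v =>
    sum_mul_sum_eq (M := fun v j => realEmb v (b j)) (N := fun v j => realEmb v (d j)) h2
      (fun v => (z v : ℂ)) v
  have hyU : y ∈ U := fun v => by
    have := hT_im W v
    rw [hTW] at this
    rw [← this]
    exact (z v).im_pos
  have hs := ha x y hyU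
  have hΨz : Ψ (tubePoint x y) = φ z := by
    rw [hW]
    change φ _ = _
    congr 1
    funext v
    rw [hTW, ofComplex_apply]
  rw [hΨz, hW] at hs
  refine hs.congr_fun fun m => ?_
  simp only [Function.comp_apply, Subtype.coe_eta, Equiv.symm_apply_apply]
  rw [dif_pos (e m).2, he, qPow_sum]

/-- Fourier expansions are unique. -/
theorem IsFourierExpansion.unique (hL : L ≠ 0) {φ : HalfSpace F → ℂ} {a a' : F → ℂ}
    (ha : IsFourierExpansion φ L a) (ha' : IsFourierExpansion φ L a') : a = a' := by
  classical
  obtain ⟨n, d, e, he⟩ := exists_lattice_basis hL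
  obtain ⟨b, htr, h1, h2⟩ := exists_dual_basis d
  -- The height that `b` sends to imaginary part `1` at every place. The expansions are compared on
  -- this one horizontal torus only.
  let y : Fin n → ℝ := fun j => ∑ v, realEmb v (d j)
  have hy : ∀ v, ∑ j, y j * realEmb v (b j) = 1 := by
    intro v
    have := sum_mul_sum_eq (M := fun v j => realEmb v (b j)) (N := fun v j => realEmb v (d j)) h2
      (fun _ => (1 : ℂ)) v
    simp only [mul_one] at this
    exact_mod_cast this
  have hzero : (fun m => (a (e m) - a' (e m)) *
      (Real.exp (-(2 * Real.pi * ∑ j, (m j : ℝ) * y j)) : ℂ)) = 0 := by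
    refine fourierSeries_eq_zero fun x => ?_
    have him : ∀ v, (∑ j, tubePoint x y j * (realEmb v (b j) : ℂ)).im = 1 := fun v => by
      rw [← hy v]
      simp [Complex.im_sum, tubePoint]
    let z : HalfSpace F := fun v => ⟨∑ j, tubePoint x y j * (realEmb v (b j) : ℂ), by
      rw [him]; exact one_pos⟩
    have hz : (fun j => ∑ v, (realEmb v (d j) : ℂ) * z v) = tubePoint x y := by
      funext j
      have := sum_mul_sum_eq (M := fun j v => realEmb v (d j)) (N := fun j v => realEmb v (b j)) h1
        (tubePoint x y) j
      rw [← this]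
      refine Finset.sum_congr rfl fun v _ => ?_
      rw [mul_comm]
      congr 1
      change ∑ j, tubePoint x y j * (realEmb v (b j) : ℂ) = _
      exact Finset.sum_congr rfl fun j _ => mul_comm _ _
    have h := (ha.2 z).sub (ha'.2 z)
    rw [sub_self, ← e.hasSum_iff] at h
    refine h.congr_fun fun m => ?_
    simp only [Function.comp_apply]
    have hq : qPow (e m : F) z = expSum m (tubePoint x y) := by rw [he, qPow_sum, hz]
    rw [hq, expSum_tubePoint]
    ring
  funext μ
  by_cases hμ : μ ∈ L
  · obtain ⟨m, hm⟩ := e.surjective ⟨μ, hμ⟩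
    have := congrFun hzero m
    rw [hm] at this
    simpa [sub_eq_zero, ← Complex.ofReal_exp] using this
  · rw [ha.1 μ hμ, ha'.1 μ hμ]

lemma isFourierExpansion_fourierCoeff {φ : HalfSpace F → ℂ} (h : ∃ a, IsFourierExpansion φ L a) :
    IsFourierExpansion φ L (fourierCoeff φ L) := by
  rw [fourierCoeff, dif_pos h]
  exact h.choose_spec

end Expansion

end

end HilbertModular

namespace HilbertModular

noncomputable section

/-! ### Valuations, ideals and ideles -/

section Ideles

variable {F : Type*} [Field F] [NumberField F]

/-- Writing `x = n/d`, both sides are differences of the orders of `n` and `d`. This ties the local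
inequalities of `MemIdealHat` to membership in fractional ideals. -/
lemma valuation_eq_exp_neg_count (v : HeightOneSpectrum (𝓞 F)) {x : F} (hx : x ≠ 0) :
    v.valuation F x =
      WithZero.exp (-(FractionalIdeal.count F v (FractionalIdeal.spanSingleton (𝓞 F)⁰ x))) := by
  obtain ⟨n, d, hd, rfl⟩ := IsFractionRing.div_surjective (A := 𝓞 F) x
  have hd0 : d ≠ 0 := nonZeroDivisors.ne_zero hd
  have hn0 : n ≠ 0 := by
    rintro rfl
    simp at hx
  have h0 : FractionalIdeal.spanSingleton (𝓞 F)⁰ (algebraMap (𝓞 F) F n / algebraMap (𝓞 F) F d) ≠ 0 :=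
    FractionalIdeal.spanSingleton_ne_zero_iff.2 hx
  rw [FractionalIdeal.count_well_defined F v h0 (a := d) (J := Ideal.span {n}), map_div₀,
    HeightOneSpectrum.valuation_of_algebraMap, HeightOneSpectrum.valuation_of_algebraMap,
    v.intValuation_if_neg hn0, v.intValuation_if_neg hd0, ← WithZero.exp_sub]
  · congr 1; ring
  · rw [FractionalIdeal.coeIdeal_span_singleton, FractionalIdeal.spanSingleton_mul_spanSingleton,
      div_eq_inv_mul]

lemma memIdealHat_algebraMap {I : FractionalIdeal (𝓞 F)⁰ F} {x : F} (hx : x ∈ I) :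
    MemIdealHat I (algebraMap F (FinAdeles F) x) := by
  intro v
  rw [FiniteAdeleRing.algebraMap_apply, HeightOneSpectrum.valuedAdicCompletion_eq_valuation']
  by_cases h0 : x = 0
  · simp [h0]
  rw [valuation_eq_exp_neg_count v h0, WithZero.exp_le_exp, neg_le_neg_iff]
  exact FractionalIdeal.count_mono F v (FractionalIdeal.spanSingleton_ne_zero_iff.2 h0)
    (FractionalIdeal.spanSingleton_le_iff_mem.2 hx)

lemma MemIdealHat.mul {I J : FractionalIdeal (𝓞 F)⁰ F} (hI : I ≠ 0) (hJ : J ≠ 0)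
    {x y : FinAdeles F} (hx : MemIdealHat I x) (hy : MemIdealHat J y) :
    MemIdealHat (I * J) (x * y) := by
  intro v
  have : (x * y) v = x v * y v := rfl
  rw [this, map_mul, FractionalIdeal.count_mul F v hI hJ, neg_add, WithZero.exp_add]
  exact mul_le_mul' (hx v) (hy v)

lemma valued_idele_ne_zero (t : (FinAdeles F)ˣ) (v : HeightOneSpectrum (𝓞 F)) :
    Valued.v (t.1 v) ≠ 0 :=
  (Valuation.ne_zero_iff _).2 ((FiniteAdeleRing.isUnit_iff.1 t.isUnit).1 v)

lemma count_ideleIdeal (t : (FinAdeles F)ˣ) (v : HeightOneSpectrum (𝓞 F)) :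
    FractionalIdeal.count F v (ideleIdeal t) = -(WithZero.log (Valued.v (t.1 v))) := by
  refine FractionalIdeal.count_finprod F v (fun v => -(WithZero.log (Valued.v (t.1 v)))) ?_
  filter_upwards [(FiniteAdeleRing.isUnit_iff.1 t.isUnit).2] with v hv
  simp [hv]

lemma ideleIdeal_ne_zero (t : (FinAdeles F)ˣ) : ideleIdeal t ≠ 0 := by
  rw [ideleIdeal]
  refine finprod_induction (p := fun I : FractionalIdeal (𝓞 F)⁰ F => I ≠ 0) one_ne_zero
    (fun _ _ => mul_ne_zero) fun v => zpow_ne_zero _ (FractionalIdeal.coeIdeal_ne_zero.2 v.ne_bot)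

lemma memIdealHat_ideleIdeal (t : (FinAdeles F)ˣ) : MemIdealHat (ideleIdeal t) t.1 := by
  intro v
  rw [count_ideleIdeal, neg_neg, WithZero.exp_log (valued_idele_ne_zero t v)]

lemma different_ne_zero : (different F : FractionalIdeal (𝓞 F)⁰ F) ≠ 0 :=
  FractionalIdeal.coeIdeal_ne_zero.2 differentIdeal_ne_bot

/-- An element that is dual to `I` under the trace lies in `I⁻¹𝔡⁻¹`. -/
lemma mem_inv_mul_different_inv {I : FractionalIdeal (𝓞 F)⁰ F} (hI : I ≠ 0) {b : F}
    (hb : ∀ a ∈ I, ∃ n : ℤ, Algebra.trace ℚ F (a * b) = n) :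
    b ∈ (different F : FractionalIdeal (𝓞 F)⁰ F)⁻¹ * I⁻¹ := by
  rw [different, coeIdeal_differentIdeal ℤ ℚ F (𝓞 F), inv_inv,
    ← FractionalIdeal.dual_eq_mul_inv, FractionalIdeal.mem_dual hI]
  intro a ha
  obtain ⟨n, hn⟩ := hb a ha
  refine ⟨n, ?_⟩
  rw [Algebra.traceForm_apply, mul_comm, hn]
  simp

lemma memIdealHat_zero (I : FractionalIdeal (𝓞 F)⁰ F) : MemIdealHat I (0 : FinAdeles F) := by
  intro v
  have : (0 : FinAdeles F) v = 0 := rfl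
  simp [this]

lemma memIdealHat_one : MemIdealHat 1 (1 : FinAdeles F) := by
  rw [← map_one (algebraMap F (FinAdeles F))]
  exact memIdealHat_algebraMap (FractionalIdeal.one_mem_one _)

lemma valued_one (v : HeightOneSpectrum (𝓞 F)) : Valued.v ((1 : FinAdeles F) v) = 1 := by
  have : (1 : FinAdeles F) v = 1 := rfl
  rw [this, map_one]

end Ideles

/-! ### Adelic matrices -/

section Matrices

/-- The unipotent matrix `(1, b; 0, 1)`. -/
def unipGL {R : Type*} [CommRing R] (b : R) : GL (Fin 2) R where
  val := !![1, b; 0, 1]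
  inv := !![1, -b; 0, 1]
  val_inv := by rw [Matrix.mul_fin_two, Matrix.one_fin_two]; simp
  inv_val := by rw [Matrix.mul_fin_two, Matrix.one_fin_two]; simp

/-- The diagonal matrix `diag(u, 1)`. -/
def diagGL {R : Type*} [CommRing R] (u : Rˣ) : GL (Fin 2) R where
  val := !![u.1, 0; 0, 1]
  inv := !![(u⁻¹).1, 0; 0, 1]
  val_inv := by rw [Matrix.mul_fin_two, Matrix.one_fin_two]; simp
  inv_val := by rw [Matrix.mul_fin_two, Matrix.one_fin_two]; simp

lemma map_unipGL {R S : Type*} [CommRing R] [CommRing S] (φ : R →+* S) (b : R) :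
    Matrix.GeneralLinearGroup.map φ (unipGL b) = unipGL (φ b) := by
  ext i j
  fin_cases i <;> fin_cases j <;> simp [unipGL]

lemma map_diagGL {R S : Type*} [CommRing R] [CommRing S] (φ : R →+* S) (u : Rˣ) :
    Matrix.GeneralLinearGroup.map φ (diagGL u) = diagGL (Units.map φ.toMonoidHom u) := by
  ext i j
  fin_cases i <;> fin_cases j <;> simp [diagGL]

variable {F : Type*} [Field F] [NumberField F]

/-- Passing `diag(t⁻¹, 1)` multiplies the upper right entry by `t`, so that `b ∈ (t𝔡)⁻¹` turns into
an entry in `𝔡⁻¹𝒪̂`. This is why the components have period lattice `(t𝔡)⁻¹`. -/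
lemma unipGL_mul_alphaMat (t : (FinAdeles F)ˣ) (b : FinAdeles F) :
    unipGL b * alphaMat t = alphaMat t * unipGL (t.1 * b) := by
  apply Units.ext
  simp only [Units.val_mul, unipGL, alphaMat, Matrix.mul_fin_two]
  simp

lemma diagGL_mul_alphaMat (t u : (FinAdeles F)ˣ) :
    diagGL u * alphaMat t = alphaMat t * diagGL u := by
  apply Units.ext
  simp only [Units.val_mul, diagGL, alphaMat, Matrix.mul_fin_two]
  simp [mul_comm]

lemma unipGL_mem_levelK {b : FinAdeles F}
    (hb : MemIdealHat (different F : FractionalIdeal (𝓞 F)⁰ F)⁻¹ b) : unipGL b ∈ levelK F := by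
  refine ⟨memIdealHat_one, hb, memIdealHat_zero _, memIdealHat_one, fun v => ?_⟩
  have : (unipGL b).1.det = 1 := by simp [unipGL, Matrix.det_fin_two_of]
  rw [this, valued_one]

lemma diagGL_mem_levelK (ε : (𝓞 F)ˣ) :
    diagGL (Units.map (algebraMap F (FinAdeles F)).toMonoidHom
      (Units.map (algebraMap (𝓞 F) F).toMonoidHom ε)) ∈ levelK F := by
  have hmem : MemIdealHat 1 (algebraMap F (FinAdeles F) (algebraMap (𝓞 F) F ε)) :=
    memIdealHat_algebraMap (FractionalIdeal.coe_mem_one _ _)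
  refine ⟨hmem, memIdealHat_zero _, memIdealHat_zero _, memIdealHat_one, fun v => ?_⟩
  have : (diagGL (Units.map (algebraMap F (FinAdeles F)).toMonoidHom
      (Units.map (algebraMap (𝓞 F) F).toMonoidHom ε))).1.det =
      algebraMap F (FinAdeles F) (algebraMap (𝓞 F) F ε) := by
    simp [diagGL, Matrix.det_fin_two_of]
  rw [this, FiniteAdeleRing.algebraMap_apply, HeightOneSpectrum.valuedAdicCompletion_eq_valuation',
    HeightOneSpectrum.valuation_eq_one_iff_notMem]
  exact fun h => v.isPrime.ne_top (Ideal.eq_top_of_isUnit_mem _ h ε.isUnit)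

variable [IsTotallyReal F]

lemma adelicGL_mul (x x' : GL (Fin 2) (FinAdeles F)) (g g' : InfinitePlace F → GL (Fin 2) ℝ) :
    adelicGL (x * x') (g * g') = adelicGL x g * adelicGL x' g' := by
  apply Units.ext
  ext i j
  rw [Units.val_mul, Matrix.mul_apply, Fin.sum_univ_two]
  refine Prod.ext ?_ ?_
  · funext v
    change (completionEquiv v).symm (((g v).1 * (g' v).1) i j) = _
    rw [Matrix.mul_apply, Fin.sum_univ_two, map_add, map_mul, map_mul]
    rfl
  · change (x.1 * x'.1) i j = _
    rw [Matrix.mul_apply, Fin.sum_univ_two]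
    rfl

omit [NumberField F] in
lemma completionEquiv_coe (v : InfinitePlace F) (x : F) :
    completionEquiv v (algebraMap F v.Completion x) = realEmb v x :=
  InfinitePlace.Completion.extensionEmbeddingOfIsReal_coe (IsTotallyReal.isReal v)
    (WithAbs.toAbs v.1 x)

lemma map_algebraMap_adeles (γ : GL (Fin 2) F) :
    Matrix.GeneralLinearGroup.map (algebraMap F (Adeles F)) γ =
      adelicGL (Matrix.GeneralLinearGroup.map (algebraMap F (FinAdeles F)) γ)
        fun v => Matrix.GeneralLinearGroup.map (realEmb v) γ := by
  apply Units.ext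
  ext i j
  refine Prod.ext ?_ ?_
  · funext v
    change algebraMap F v.Completion (γ.1 i j) = (completionEquiv v).symm (realEmb v (γ.1 i j))
    rw [← completionEquiv_coe, RingEquiv.symm_apply_apply]
  · rfl

/-- A rational `γ` acts at all places at once. Left invariance removes it, and its finite part is
absorbed on the right by the level group, which leaves invariance under its archimedean part alone.
-/
lemma IsModularForm.apply_adelicGL {k : ℤ} {f : GL (Fin 2) (Adeles F) → ℂ} (hf : IsModularForm k f)
    (γ : GL (Fin 2) F) {x u : GL (Fin 2) (FinAdeles F)} (hu : u ∈ levelK F)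
    (hγ : Matrix.GeneralLinearGroup.map (algebraMap F (FinAdeles F)) γ * x = x * u)
    (g : InfinitePlace F → GL (Fin 2) ℝ) :
    f (adelicGL x fun v => Matrix.GeneralLinearGroup.map (realEmb v) γ * g v) =
      f (adelicGL x g) := by
  rw [← hf.left_invariant γ (adelicGL x g), map_algebraMap_adeles, ← adelicGL_mul, hγ,
    ← hf.right_invariant (adelicGL x _) u hu, ← adelicGL_mul, mul_one]
  rfl

end Matrices

/-! ### Components -/

section Components

variable {F : Type*} [Field F] [NumberField F] [IsTotallyReal F]

lemma det_toPoint (z : ℍ) : (toPoint z).1.det = z.im := by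
  simp [toPoint, Matrix.GeneralLinearGroup.mkOfDetNeZero, Matrix.det_fin_two_of]

lemma denom_toPoint (z w : ℍ) : denom (toPoint z) w = 1 := by
  simp [denom, toPoint, Matrix.GeneralLinearGroup.mkOfDetNeZero]

lemma toPoint_smul_I (z : ℍ) : toPoint z • UpperHalfPlane.I = z := by
  have hdet : 0 < (toPoint z).det.val := by
    rw [Matrix.GeneralLinearGroup.val_det_apply]
    exact (det_toPoint z).symm ▸ z.im_pos
  apply UpperHalfPlane.ext
  rw [coe_smul_of_det_pos hdet, denom_toPoint, div_one]
  simp only [num, toPoint, Matrix.GeneralLinearGroup.mkOfDetNeZero, coe_I]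
  apply Complex.ext <;> simp

lemma toPoint_vadd (b : ℝ) (z : ℍ) : toPoint (b +ᵥ z) = unipGL b * toPoint z := by
  apply Units.ext
  simp [unipGL, toPoint, Matrix.GeneralLinearGroup.mkOfDetNeZero, add_comm]

lemma component_eq (k : ℤ) (f : GL (Fin 2) (Adeles F) → ℂ) (t : (FinAdeles F)ˣ)
    (z : HalfSpace F) :
    component k f t z = (((∏ v, (z v).im) ^ (-(k : ℝ) / 2) : ℝ) : ℂ) *
      f (adelicGL (alphaMat t) fun v => toPoint (z v)) := by
  simp [component, archValue, detPow, autJ, det_toPoint, denom_toPoint]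

lemma IsModularForm.component_isHolomorphic {k : ℤ} {f : GL (Fin 2) (Adeles F) → ℂ}
    (hf : IsModularForm k f) (t : (FinAdeles F)ˣ) : IsHolomorphic (component k f t) := by
  obtain ⟨φ, hφ, h⟩ := hf.holomorphic (alphaMat t)
  convert hφ using 1
  funext z
  have := h (fun v => toPoint (z v)) fun v => (det_toPoint (z v)).symm ▸ (z v).im_pos
  simp only [basePt, toPoint_smul_I] at this
  rw [this]
  rfl

lemma IsModularForm.component_translate {k : ℤ} {f : GL (Fin 2) (Adeles F) → ℂ}
    (hf : IsModularForm k f) (t : (FinAdeles F)ˣ) {b : F}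
    (hb : b ∈ (different F : FractionalIdeal (𝓞 F)⁰ F)⁻¹ * (ideleIdeal t)⁻¹) (z : HalfSpace F) :
    component k f t (translate b z) = component k f t z := by
  rw [component_eq, component_eq]
  simp only [translate, vadd_im, toPoint_vadd]
  congr 1
  have hK : unipGL (t.1 * algebraMap F (FinAdeles F) b) ∈ levelK F := by
    refine unipGL_mem_levelK ?_
    have := (memIdealHat_ideleIdeal t).mul (ideleIdeal_ne_zero t)
      (mul_ne_zero (inv_ne_zero different_ne_zero) (inv_ne_zero (ideleIdeal_ne_zero t)))
      (memIdealHat_algebraMap hb)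
    rwa [mul_comm (ideleIdeal t), mul_assoc, inv_mul_cancel₀ (ideleIdeal_ne_zero t), mul_one]
      at this
  have := hf.apply_adelicGL (unipGL b) (x := alphaMat t) hK
    (by rw [map_unipGL, unipGL_mul_alphaMat]) fun v => toPoint (z v)
  simpa only [map_unipGL] using this

/-- Componentwise multiplication by a totally positive element. -/
def scale (ε : F) (hε : TotPos ε) (z : HalfSpace F) : HalfSpace F := fun v =>
  (⟨realEmb v ε, hε v⟩ : {x : ℝ // 0 < x}) • z v

omit [NumberField F] in
lemma coe_scale (ε : F) (hε : TotPos ε) (z : HalfSpace F) (v : InfinitePlace F) :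
    (scale ε hε z v : ℂ) = realEmb v ε * (z v : ℂ) := by
  rw [scale, coe_pos_real_smul]
  simp

omit [NumberField F] in
lemma toPoint_scale (ε : (𝓞 F)ˣ) (hε : TotPos (ε : F)) (z : HalfSpace F) (v : InfinitePlace F) :
    toPoint (scale (ε : F) hε z v) = Matrix.GeneralLinearGroup.map (realEmb v)
      (diagGL (Units.map (algebraMap (𝓞 F) F).toMonoidHom ε)) * toPoint (z v) := by
  rw [map_diagGL]
  apply Units.ext
  have h1 : (scale (ε : F) hε z v).im = realEmb v (ε : F) * (z v).im := by
    rw [← coe_im, coe_scale]; simp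
  have h2 : (scale (ε : F) hε z v).re = realEmb v (ε : F) * (z v).re := by
    rw [← coe_re, coe_scale]; simp
  simpa [diagGL, toPoint, Matrix.GeneralLinearGroup.mkOfDetNeZero] using ⟨h1, h2⟩

lemma prod_realEmb_unit (ε : (𝓞 F)ˣ) (hε : TotPos (ε : F)) : ∏ v, realEmb v (ε : F) = 1 := by
  have h : |∏ v, realEmb v (ε : F)| = 1 := by
    rw [prod_realEmb]
    have := NumberField.isUnit_iff_norm.1 ε.isUnit
    rw [RingOfIntegers.coe_norm] at this
    exact_mod_cast this
  rwa [abs_of_pos (Finset.prod_pos fun v _ => hε v)] at h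

/-- This is the action of `diag(ε, 1)`, whose finite part lies in the level group and commutes with
`alphaMat t`. No weight factor appears because a totally positive unit has norm `1`. -/
lemma IsModularForm.component_scale {k : ℤ} {f : GL (Fin 2) (Adeles F) → ℂ}
    (hf : IsModularForm k f) (t : (FinAdeles F)ˣ) (ε : (𝓞 F)ˣ) (hε : TotPos (ε : F))
    (z : HalfSpace F) : component k f t (scale (ε : F) hε z) = component k f t z := by
  rw [component_eq, component_eq]
  have him : ∏ v, (scale (ε : F) hε z v).im = ∏ v, (z v).im := by
    have : ∀ v, (scale (ε : F) hε z v).im = realEmb v (ε : F) * (z v).im := fun v => by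
      rw [← coe_im, coe_scale]; simp
    simp only [this]
    rw [Finset.prod_mul_distrib, prod_realEmb_unit ε hε, one_mul]
  rw [him]
  congr 1
  simp only [toPoint_scale]
  refine hf.apply_adelicGL _ (diagGL_mem_levelK ε) ?_ _
  rw [map_diagGL, diagGL_mul_alphaMat]

/-- Components of modular forms have Fourier expansions. -/
theorem IsModularForm.isFourierExpansion {k : ℤ} {f : GL (Fin 2) (Adeles F) → ℂ}
    (hf : IsModularForm k f) (t : (FinAdeles F)ˣ) :
    IsFourierExpansion (component k f t) (ideleIdeal t) (compCoeff k f t) :=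
  isFourierExpansion_fourierCoeff <| exists_isFourierExpansion (ideleIdeal_ne_zero t)
    (hf.component_isHolomorphic t) fun _ hb z =>
      hf.component_translate t (mem_inv_mul_different_inv (ideleIdeal_ne_zero t) hb) z

end Components

end

end HilbertModular

namespace HilbertModular

noncomputable section

/-! ### Unit invariance of Fourier coefficients and the Koecher principle -/

section Koecher

variable {F : Type*} [Field F] [NumberField F] [IsTotallyReal F]

omit [NumberField F] in
lemma TotPos.mul {a b : F} (ha : TotPos a) (hb : TotPos b) : TotPos (a * b) := fun v => by
  rw [map_mul]; exact mul_pos (ha v) (hb v)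

omit [NumberField F] in
lemma TotPos.inv {a : F} (ha : TotPos a) : TotPos a⁻¹ := fun v => by
  rw [map_inv₀]; exact inv_pos.2 (ha v)

lemma TotPos.add {a b : F} (ha : TotPos a) (hb : TotPos b) : TotPos (a + b) := fun v => by
  rw [map_add]; exact add_pos (ha v) (hb v)

lemma TotPos.ne_zero {a : F} (ha : TotPos a) : a ≠ 0 := by
  rintro rfl
  obtain ⟨v⟩ : Nonempty (InfinitePlace F) := inferInstance
  simpa using ha v

omit [NumberField F] in
lemma totPos_natCast {n : ℕ} (hn : 0 < n) : TotPos (n : F) := fun v => by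
  rw [map_natCast]; exact_mod_cast hn

lemma TotPos.of_mul_right {a b : F} (hab : TotPos (a * b)) (hb : TotPos b) : TotPos a := by
  simpa [mul_assoc, mul_inv_cancel₀ hb.ne_zero] using hab.mul hb.inv

lemma qPow_add (μ ν : F) (z : HalfSpace F) : qPow (μ + ν) z = qPow μ z * qPow ν z := by
  rw [qPow, qPow, qPow, ← Complex.exp_add, ← mul_add, ← Finset.sum_add_distrib]
  congr 2
  refine Finset.sum_congr rfl fun v _ => ?_
  rw [map_add]
  push_cast
  ring

lemma qPow_scale (ε : F) (hε : TotPos ε) (μ : F) (z : HalfSpace F) :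
    qPow μ (scale ε hε z) = qPow (ε * μ) z := by
  rw [qPow, qPow]
  congr 2
  refine Finset.sum_congr rfl fun v _ => ?_
  rw [coe_scale, map_mul]
  push_cast
  ring

lemma norm_qPow_basePt (μ : F) :
    ‖qPow μ (basePt F)‖ = Real.exp (-(2 * Real.pi * ∑ v, realEmb v μ)) := by
  rw [qPow, Complex.norm_exp]
  congr 1
  simp only [basePt, coe_I, ← Finset.sum_mul]
  rw [← Complex.ofReal_sum]
  simp [Complex.mul_re, Complex.mul_im]

omit [NumberField F] [IsTotallyReal F] in
lemma unit_mul_mem_iff {L : FractionalIdeal (𝓞 F)⁰ F} (ε : (𝓞 F)ˣ) {μ : F} :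
    (ε : F) * μ ∈ L ↔ μ ∈ L := by
  have h : ∀ (δ : (𝓞 F)ˣ) {x : F}, x ∈ L → (δ : F) * x ∈ L := fun δ x hx => by
    have := (L : Submodule (𝓞 F) F).smul_mem (δ : 𝓞 F) hx
    rwa [Algebra.smul_def] at this
  refine ⟨fun hμ => ?_, h ε⟩
  have := h ε⁻¹ hμ
  rwa [← mul_assoc, ← map_mul, Units.inv_mul, map_one, one_mul] at this

/-- Substituting `εz` for `z` permutes the indices of the expansion and leaves the component fixed,
so uniqueness identifies the coefficients. -/
theorem IsModularForm.compCoeff_unit_mul {k : ℤ} {f : GL (Fin 2) (Adeles F) → ℂ}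
    (hf : IsModularForm k f) (t : (FinAdeles F)ˣ) (ε : (𝓞 F)ˣ) (hε : TotPos (ε : F)) (μ : F) :
    compCoeff k f t ((ε : F) * μ) = compCoeff k f t μ := by
  have hexp := hf.isFourierExpansion t
  have h2 : IsFourierExpansion (component k f t) (ideleIdeal t)
      (fun μ => compCoeff k f t ((ε : F) * μ)) := by
    refine ⟨fun μ hμ => hexp.1 _ fun h => hμ ((unit_mul_mem_iff ε).1 h), fun z => ?_⟩
    let e : {μ : F // μ ∈ ideleIdeal t} ≃ {μ : F // μ ∈ ideleIdeal t} :=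
      { toFun := fun μ => ⟨(ε : F) * μ, (unit_mul_mem_iff ε).2 μ.2⟩
        invFun := fun μ => ⟨((ε⁻¹ : (𝓞 F)ˣ) : F) * μ, (unit_mul_mem_iff ε⁻¹).2 μ.2⟩
        left_inv := fun μ => by
          apply Subtype.ext
          change ((ε⁻¹ : (𝓞 F)ˣ) : F) * ((ε : F) * μ) = μ
          rw [← mul_assoc, ← map_mul, Units.inv_mul, map_one, one_mul]
        right_inv := fun μ => by
          apply Subtype.ext
          change (ε : F) * (((ε⁻¹ : (𝓞 F)ˣ) : F) * μ) = μ
          rw [← mul_assoc, ← map_mul, Units.mul_inv, map_one, one_mul] }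
    obtain ⟨w, hw⟩ : ∃ w, scale (ε : F) hε w = z := by
      refine ⟨scale (ε : F)⁻¹ hε.inv z, ?_⟩
      funext v
      apply UpperHalfPlane.ext
      rw [coe_scale, coe_scale, map_inv₀, Complex.ofReal_inv,
        mul_inv_cancel_left₀ (Complex.ofReal_ne_zero.2 (hε v).ne')]
    have hs := hexp.2 w
    rw [← e.hasSum_iff, ← hf.component_scale t ε hε w, hw] at hs
    refine hs.congr_fun fun μ => ?_
    change compCoeff k f t ((ε : F) * μ) * qPow (μ : F) z =
      compCoeff k f t ((ε : F) * μ) * qPow ((ε : F) * μ) w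
    rw [← hw, qPow_scale]
  exact congrFun (h2.unique (ideleIdeal_ne_zero t) hexp) μ

/-- A totally positive unit that is large at one place and small at all others. -/
lemma exists_totPos_unit (hF : 1 < Module.finrank ℚ F) (v₀ : InfinitePlace F) :
    ∃ ε : (𝓞 F)ˣ, TotPos (ε : F) ∧ 1 < realEmb v₀ (ε : F) ∧
      ∀ w, w ≠ v₀ → realEmb w (ε : F) < 1 := by
  classical
  -- Dirichlet's theorem supplies a unit small at every place other than `v₀`; squaring makes it
  -- totally positive.
  obtain ⟨u, hu⟩ := Units.dirichletUnitTheorem.exists_unit F v₀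
  have hsq : ∀ w, realEmb w ((u ^ 2 : (𝓞 F)ˣ) : F) = w (u : F) ^ 2 := fun w => by
    rw [Units.val_pow_eq_pow_val, map_pow, map_pow, ← abs_realEmb, sq_abs]
  have hne : ((u : 𝓞 F) : F) ≠ 0 := Units.coe_ne_zero u
  have hpos : TotPos ((u ^ 2 : (𝓞 F)ˣ) : F) := fun w => by
    rw [hsq]; exact pow_pos (InfinitePlace.pos_iff.2 hne) 2
  have hlt : ∀ w, w ≠ v₀ → realEmb w ((u ^ 2 : (𝓞 F)ˣ) : F) < 1 := fun w hw => by
    rw [hsq]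
    have := (Real.log_neg_iff (InfinitePlace.pos_iff.2 hne)).1 (hu w hw)
    exact pow_lt_one₀ (apply_nonneg _ _) this two_ne_zero
  refine ⟨u ^ 2, hpos, ?_, hlt⟩
  -- Otherwise all embeddings are at most `1`, with strict inequality at a second place, against the
  -- norm being `1`.
  by_contra! hle
  rw [← card_infinitePlace] at hF
  have : Nontrivial (InfinitePlace F) := Fintype.one_lt_card_iff_nontrivial.1 hF
  obtain ⟨w, hw⟩ := exists_ne v₀
  have hprod : ∏ v, realEmb v ((u ^ 2 : (𝓞 F)ˣ) : F) < ∏ _v : InfinitePlace F, (1 : ℝ) :=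
    Finset.prod_lt_prod (fun v _ => hpos v)
      (fun v _ => if h : v = v₀ then h ▸ hle else (hlt v h).le) ⟨w, Finset.mem_univ _, hlt w hw⟩
  rw [prod_realEmb_unit _ hpos] at hprod
  simp at hprod

/-- The Koecher principle: Fourier coefficients are supported on zero and the totally positive
elements. -/
theorem IsModularForm.compCoeff_eq_zero (hF : 1 < Module.finrank ℚ F) {k : ℤ}
    {f : GL (Fin 2) (Adeles F) → ℂ} (hf : IsModularForm k f) (t : (FinAdeles F)ˣ) {μ : F}
    (hμ0 : μ ≠ 0) (hμ : ¬ TotPos μ) : compCoeff k f t μ = 0 := by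
  by_cases hmem : μ ∈ ideleIdeal t
  swap
  · exact (hf.isFourierExpansion t).1 μ hmem
  obtain ⟨v₀, hv₀⟩ : ∃ v₀, realEmb v₀ μ < 0 := by
    rw [TotPos] at hμ
    push Not at hμ
    obtain ⟨v, hv⟩ := hμ
    exact ⟨v, lt_of_le_of_ne hv (realEmb_ne_zero v hμ0)⟩
  obtain ⟨ε, hε, hε₀, hε₁⟩ := exists_totPos_unit hF v₀
  have hpow : ∀ n : ℕ, TotPos ((ε ^ n : (𝓞 F)ˣ) : F) := fun n v => by
    rw [Units.val_pow_eq_pow_val, map_pow, map_pow]; exact pow_pos (hε v) n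
  -- Along the orbit `ε^n μ` the coefficient is constant, while `Tr(ε^n μ)` stays below `C`: the
  -- term at `v₀` is negative and the others shrink in absolute value. So the terms at the base
  -- point are bounded below by a multiple of `‖a(μ)‖`, yet they are distinct terms of a convergent
  -- series and tend to zero.
  let s : ℕ → {μ : F // μ ∈ ideleIdeal t} := fun n =>
    ⟨((ε ^ n : (𝓞 F)ˣ) : F) * μ, (unit_mul_mem_iff _).2 hmem⟩
  have hs : Function.Injective s := by
    intro m n hmn
    have h1 : ((ε ^ m : (𝓞 F)ˣ) : F) * μ = ((ε ^ n : (𝓞 F)ˣ) : F) * μ := congrArg Subtype.val hmn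
    have h2 := congrArg (realEmb v₀) (mul_right_cancel₀ hμ0 h1)
    rw [Units.val_pow_eq_pow_val, map_pow, map_pow, Units.val_pow_eq_pow_val, map_pow, map_pow] at h2
    exact (pow_right_strictMono₀ hε₀).injective h2
  have htend := (((hf.isFourierExpansion t).2 (basePt F)).summable.tendsto_cofinite_zero.comp
    hs.tendsto_cofinite).norm
  rw [Nat.cofinite_eq_atTop, norm_zero] at htend
  set C := ∑ v, |realEmb v μ| with hC
  have hlow : ∀ n, ‖compCoeff k f t μ‖ * Real.exp (-(2 * Real.pi * C)) ≤
      ‖compCoeff k f t (s n) * qPow (s n : F) (basePt F)‖ := by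
    intro n
    rw [norm_mul, norm_qPow_basePt, hf.compCoeff_unit_mul t (ε ^ n) (hpow n)]
    refine mul_le_mul_of_nonneg_left (Real.exp_le_exp.2 (neg_le_neg ?_)) (norm_nonneg _)
    refine mul_le_mul_of_nonneg_left (Finset.sum_le_sum fun v _ => ?_) (by positivity)
    rw [map_mul]
    by_cases hv : v = v₀
    · subst hv
      exact (mul_neg_of_pos_of_neg (hpow n v) hv₀).le.trans (abs_nonneg _)
    · refine (le_abs_self _).trans ?_
      rw [abs_mul, abs_of_pos (hpow n v)]
      refine mul_le_of_le_one_left (abs_nonneg _) ?_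
      rw [Units.val_pow_eq_pow_val, map_pow, map_pow]
      exact pow_le_one₀ (hε v).le (hε₁ v hv).le
  have := ge_of_tendsto' htend hlow
  have h0 : ‖compCoeff k f t μ‖ ≤ 0 := nonpos_of_mul_nonpos_left this (Real.exp_pos _)
  exact norm_le_zero_iff.1 h0

end Koecher

/-! ### Products -/

section Products

variable {F : Type*} [Field F] [NumberField F] [IsTotallyReal F]

/-- The Fourier expansion of a product. -/
theorem IsFourierExpansion.mul {L : FractionalIdeal (𝓞 F)⁰ F} {φ₁ φ₂ : HalfSpace F → ℂ}
    {a b : F → ℂ} (ha : IsFourierExpansion φ₁ L a) (hb : IsFourierExpansion φ₂ L b) :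
    IsFourierExpansion (φ₁ * φ₂) L fun μ => ∑' ν, a ν * b (μ - ν) := by
  refine ⟨fun μ hμ => ?_, fun z => ?_⟩
  · have : ∀ ν, a ν * b (μ - ν) = 0 := fun ν => by
      by_cases hν : ν ∈ L
      · have : μ - ν ∉ L := fun h => hμ (by
          simpa using (L : Submodule (𝓞 F) F).add_mem h hν)
        rw [hb.1 _ this, mul_zero]
      · rw [ha.1 _ hν, zero_mul]
    simp [this]
  let A : {μ : F // μ ∈ L} → ℂ := fun μ => a μ * qPow (μ : F) z
  let B : {μ : F // μ ∈ L} → ℂ := fun μ => b μ * qPow (μ : F) z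
  have hA : HasSum A (φ₁ z) := ha.2 z
  have hB : HasSum B (φ₂ z) := hb.2 z
  have hAB : HasSum (fun p : {μ : F // μ ∈ L} × {μ : F // μ ∈ L} => A p.1 * B p.2)
      (φ₁ z * φ₂ z) :=
    hA.mul hB (summable_mul_of_summable_norm hA.summable.norm hB.summable.norm)
  -- The pair (total index, first index) corresponds to (first index, second index), so summing over
  -- fibres collects the terms of each `q^μ`.
  let e : {μ : F // μ ∈ L} × {μ : F // μ ∈ L} ≃ {μ : F // μ ∈ L} × {μ : F // μ ∈ L} :=
    { toFun := fun p => (p.2, ⟨p.1 - p.2, (L : Submodule (𝓞 F) F).sub_mem p.1.2 p.2.2⟩)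
      invFun := fun p => (⟨p.1 + p.2, (L : Submodule (𝓞 F) F).add_mem p.1.2 p.2.2⟩, p.1)
      left_inv := fun p => by ext <;> simp
      right_inv := fun p => by ext <;> simp }
  rw [← e.hasSum_iff] at hAB
  have hfib := hAB.prod_fiberwise fun μ => (hAB.summable.prod_factor μ).hasSum
  refine hfib.congr_fun fun μ => ?_
  -- The convolution may run over all of `F`, because `a` vanishes off `L`.
  have hsub : ∑' ν : {μ : F // μ ∈ L}, a ν * b (μ - ν) = ∑' ν, a ν * b (μ - ν) := by
    refine tsum_subtype_eq_of_support_subset (f := fun ν => a ν * b (μ - ν))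
      (s := {ν | ν ∈ L}) fun ν hν => ?_
    by_contra hν'
    exact hν (by simp only; rw [ha.1 _ hν', zero_mul])
  change (∑' ν, a ν * b (μ - ν)) * qPow (μ : F) z = _
  rw [← hsub, ← tsum_mul_right]
  refine tsum_congr fun ν => ?_
  change _ = a ν * qPow (ν : F) z * (b (μ - ν) * qPow ((μ : F) - ν) z)
  have : qPow (μ : F) z = qPow (ν : F) z * qPow ((μ : F) - ν) z := by
    rw [← qPow_add, add_sub_cancel]
  rw [this]
  ring

omit [IsTotallyReal F] in
lemma detPow_mul_self {g : InfinitePlace F → GL (Fin 2) ℝ} (hg : ∀ v, 0 < (g v).1.det) (r s : ℝ) :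
    detPow g (r + s) = detPow g r * detPow g s := by
  rw [detPow, Real.rpow_add (Finset.prod_pos fun v _ => hg v)]
  simp [detPow]

omit [IsTotallyReal F] in
lemma autJ_ne_zero (g : InfinitePlace F → GL (Fin 2) ℝ) (z : HalfSpace F) : autJ g z ≠ 0 :=
  Finset.prod_ne_zero_iff.2 fun v _ => denom_ne_zero (g v) (z v)

/-- Positive determinants make the real power additive in the exponent, and `autJ` never vanishes,
so its integer power is additive as well. -/
lemma archValue_mul (k₁ k₂ : ℤ) (f h : GL (Fin 2) (Adeles F) → ℂ)
    (x : GL (Fin 2) (FinAdeles F)) {g : InfinitePlace F → GL (Fin 2) ℝ}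
    (hg : ∀ v, 0 < (g v).1.det) :
    archValue (k₁ + k₂) (f * h) x g = archValue k₁ f x g * archValue k₂ h x g := by
  have : (-((k₁ + k₂ : ℤ) : ℝ) / 2) = -(k₁ : ℝ) / 2 + -(k₂ : ℝ) / 2 := by push_cast; ring
  rw [archValue, archValue, archValue, this, detPow_mul_self hg, zpow_add₀ (autJ_ne_zero _ _),
    Pi.mul_apply]
  ring

lemma det_pos_of_mem_realCompact {u : GL (Fin 2) ℝ} (hu : u ∈ realCompact) : 0 < u.1.det := by
  obtain ⟨r, hr, R, hR, h⟩ := hu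
  rw [h, Matrix.det_smul, (Matrix.mem_specialOrthogonalGroup_iff.1 hR).2, mul_one]
  simpa using sq_pos_of_ne_zero hr

theorem IsModularForm.mul {k₁ k₂ : ℤ} {f h : GL (Fin 2) (Adeles F) → ℂ}
    (hf : IsModularForm k₁ f) (hh : IsModularForm k₂ h) : IsModularForm (k₁ + k₂) (f * h) where
  left_invariant γ g := by
    rw [Pi.mul_apply, Pi.mul_apply, hf.left_invariant, hh.left_invariant]
  right_invariant g u hu := by
    rw [Pi.mul_apply, Pi.mul_apply, hf.right_invariant g u hu, hh.right_invariant g u hu]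
  weight g u hu := by
    have : ((k₁ + k₂ : ℤ) : ℝ) / 2 = (k₁ : ℝ) / 2 + (k₂ : ℝ) / 2 := by push_cast; ring
    rw [Pi.mul_apply, Pi.mul_apply, hf.weight g u hu, hh.weight g u hu, this,
      detPow_mul_self fun v => det_pos_of_mem_realCompact (hu v), neg_add,
      zpow_add₀ (autJ_ne_zero _ _)]
    ring
  holomorphic x := by
    obtain ⟨φ₁, h₁, e₁⟩ := hf.holomorphic x
    obtain ⟨φ₂, h₂, e₂⟩ := hh.holomorphic x
    refine ⟨φ₁ * φ₂, DifferentiableOn.mul h₁ h₂, fun g hg => ?_⟩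
    rw [Pi.mul_apply, e₁ g hg, e₂ g hg, archValue_mul _ _ _ _ _ hg]

theorem IsModularFormWithChar.mul {k₁ k₂ : ℤ} {ψ₁ ψ₂ : (Adeles F)ˣ →* ℂˣ}
    {f h : GL (Fin 2) (Adeles F) → ℂ} (hf : IsModularFormWithChar k₁ ψ₁ f)
    (hh : IsModularFormWithChar k₂ ψ₂ h) :
    IsModularFormWithChar (k₁ + k₂) (ψ₁ * ψ₂) (f * h) where
  toIsModularForm := hf.toIsModularForm.mul hh.toIsModularForm
  central a g := by
    rw [Pi.mul_apply, Pi.mul_apply, hf.central, hh.central, MonoidHom.mul_apply, Units.val_mul]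
    ring

lemma component_mul (k₁ k₂ : ℤ) (f h : GL (Fin 2) (Adeles F) → ℂ) (t : (FinAdeles F)ˣ) :
    component (k₁ + k₂) (f * h) t = component k₁ f t * component k₂ h t := by
  funext z
  exact archValue_mul _ _ _ _ _ fun v => (det_toPoint (z v)).symm ▸ (z v).im_pos

/-- The coefficients of a product are the convolutions of the coefficients. -/
theorem compCoeff_mul {k₁ k₂ : ℤ} {f h : GL (Fin 2) (Adeles F) → ℂ}
    (hf : IsModularForm k₁ f) (hh : IsModularForm k₂ h) (t : (FinAdeles F)ˣ) (μ : F) :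
    compCoeff (k₁ + k₂) (f * h) t μ = ∑' ν, compCoeff k₁ f t ν * compCoeff k₂ h t (μ - ν) := by
  have h₁ := (hf.isFourierExpansion t).mul (hh.isFourierExpansion t)
  rw [← component_mul] at h₁
  exact congrFun (((hf.mul hh).isFourierExpansion t).unique (ideleIdeal_ne_zero t) h₁) μ

/-- In `0 = ν + (-ν)` the two summands cannot both be totally positive, so only `ν = 0` survives the
Koecher principle. -/
theorem compCoeff_mul_zero (hF : 1 < Module.finrank ℚ F) {k₁ k₂ : ℤ}
    {f h : GL (Fin 2) (Adeles F) → ℂ}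
    (hf : IsModularForm k₁ f) (hh : IsModularForm k₂ h) (t : (FinAdeles F)ˣ) :
    compCoeff (k₁ + k₂) (f * h) t 0 = compCoeff k₁ f t 0 * compCoeff k₂ h t 0 := by
  rw [compCoeff_mul hf hh, tsum_eq_single 0, sub_zero]
  intro ν hν
  by_cases hpos : TotPos ν
  · have : ¬ TotPos (0 - ν) := fun h0 => by
      have := (hpos.add h0).ne_zero
      simp at this
    rw [hh.compCoeff_eq_zero hF t (by simpa using hν) this, mul_zero]
  · rw [hf.compCoeff_eq_zero hF t hν hpos, zero_mul]

/-- The coefficient of a product at a totally positive element, as a finite sum over the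
decompositions into totally positive elements. -/
theorem compCoeff_mul_of_totPos (hF : 1 < Module.finrank ℚ F) {k₁ k₂ : ℤ}
    {f h : GL (Fin 2) (Adeles F) → ℂ}
    (hf : IsModularForm k₁ f) (hh : IsModularForm k₂ h) (t : (FinAdeles F)ˣ) {n μ : F}
    (hn : TotPos n) (hμ : TotPos μ) (S : Finset F)
    (hS : ∀ α ∈ S, TotPos α ∧ TotPos (n - α))
    (hS' : ∀ α, α * μ ∈ ideleIdeal t → (n - α) * μ ∈ ideleIdeal t → TotPos α → TotPos (n - α) →
      α ∈ S) :
    compCoeff (k₁ + k₂) (f * h) t (n * μ) =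
      compCoeff k₁ f t 0 * compCoeff k₂ h t (n * μ) +
      compCoeff k₁ f t (n * μ) * compCoeff k₂ h t 0 +
      ∑ α ∈ S, compCoeff k₁ f t (α * μ) * compCoeff k₂ h t ((n - α) * μ) := by
  classical
  have hμ0 := hμ.ne_zero
  -- The indices `0` and `n` give the products with constant terms; they are disjoint from `S`
  -- because its decompositions have both parts totally positive.
  have h0S : (0 : F) ∉ insert n S := by
    rw [Finset.mem_insert]
    rintro (h | h)
    · exact hn.ne_zero h.symm
    · exact (hS 0 h).1.ne_zero rfl
  have hnS : n ∉ S := fun h => (hS n h).2.ne_zero (sub_self n)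
  rw [compCoeff_mul hf hh, tsum_eq_sum (s := (insert 0 (insert n S)).image (· * μ)),
    Finset.sum_image fun x _ y _ hxy => mul_right_cancel₀ hμ0 hxy, Finset.sum_insert h0S,
    Finset.sum_insert hnS]
  · simp only [zero_mul, sub_zero, sub_self, ← sub_mul]
    ring
  intro ν hν
  obtain ⟨α, rfl⟩ : ∃ α, ν = α * μ := ⟨ν / μ, (div_mul_cancel₀ _ hμ0).symm⟩
  have hα : α ∉ insert 0 (insert n S) := fun h => hν (Finset.mem_image_of_mem (· * μ) h)
  rw [Finset.mem_insert, Finset.mem_insert] at hα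
  push Not at hα
  rw [← sub_mul]
  -- A nonzero term has both indices in the lattice and, by the Koecher principle, totally positive.
  -- Dividing by `μ` places `α` in `S`.
  by_contra hne
  obtain ⟨h₁, h₂⟩ := mul_ne_zero_iff.1 hne
  have m₁ : α * μ ∈ ideleIdeal t := by
    by_contra hm; exact h₁ ((hf.isFourierExpansion t).1 _ hm)
  have m₂ : (n - α) * μ ∈ ideleIdeal t := by
    by_contra hm; exact h₂ ((hh.isFourierExpansion t).1 _ hm)
  have p₁ : TotPos (α * μ) := by
    by_contra hp; exact h₁ (hf.compCoeff_eq_zero hF t (mul_ne_zero hα.1 hμ0) hp)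
  have p₂ : TotPos ((n - α) * μ) := by
    by_contra hp
    exact h₂ (hh.compCoeff_eq_zero hF t (mul_ne_zero (sub_ne_zero.2 hα.2.1.symm) hμ0) hp)
  exact hα.2.2 (hS' α m₁ m₂ (p₁.of_mul_right hμ) (p₂.of_mul_right hμ))

omit [IsTotallyReal F] in
lemma ideleNorm_pos (t : (FinAdeles F)ˣ) : 0 < ideleNorm t := by
  rw [ideleNorm]
  have h0 : FractionalIdeal.absNorm (ideleIdeal t) ≠ 0 := fun h =>
    ideleIdeal_ne_zero t (FractionalIdeal.absNorm_eq_zero_iff.1 h)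
  exact_mod_cast lt_of_le_of_ne (FractionalIdeal.absNorm_nonneg _) h0.symm

omit [IsTotallyReal F] in
lemma normFactor_add (k₁ k₂ : ℤ) (t : (FinAdeles F)ˣ) :
    normFactor (k₁ + k₂) t = normFactor k₁ t * normFactor k₂ t := by
  have : (-((k₁ + k₂ : ℤ) : ℝ) / 2) = -(k₁ : ℝ) / 2 + -(k₂ : ℝ) / 2 := by push_cast; ring
  rw [normFactor, this, Real.rpow_add (ideleNorm_pos t)]
  simp [normFactor]

/-- The normalized coefficient can be computed from any representation of the ideal. -/
theorem coeff_eq {N : Type*} {t : N → (FinAdeles F)ˣ} (ht : IsNarrowRepSystem F t) {k : ℤ}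
    {f : GL (Fin 2) (Adeles F) → ℂ} (hf : IsModularForm k f) {m : Ideal (𝓞 F)} {ν : N} {μ : F}
    (hμ : TotPos μ) (hm : (m : FractionalIdeal (𝓞 F)⁰ F) =
      (ideleIdeal (t ν))⁻¹ * FractionalIdeal.spanSingleton (𝓞 F)⁰ μ) :
    coeff t k f m = normFactor k (t ν) * compCoeff k f (t ν) μ := by
  have hex : ∃ p : N × F, TotPos p.2 ∧ (m : FractionalIdeal (𝓞 F)⁰ F) =
      (ideleIdeal (t p.1))⁻¹ * FractionalIdeal.spanSingleton (𝓞 F)⁰ p.2 := ⟨(ν, μ), hμ, hm⟩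
  rw [coeff, dif_pos hex]
  obtain ⟨hp, hpm⟩ := hex.choose_spec
  generalize hex.choose = p at hp hpm ⊢
  obtain ⟨ν', μ'⟩ := p
  simp only at hp hpm ⊢
  -- The narrow class of `m⁻¹` is that of `t_ν`, so `m` determines `ν`.
  have hinv : ∀ {ν : N} {μ : F}, TotPos μ → (m : FractionalIdeal (𝓞 F)⁰ F) =
      (ideleIdeal (t ν))⁻¹ * FractionalIdeal.spanSingleton (𝓞 F)⁰ μ →
      NarrowEquiv (m : FractionalIdeal (𝓞 F)⁰ F)⁻¹ (ideleIdeal (t ν)) := by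
    intro ν μ hμ h
    refine ⟨μ⁻¹, hμ.inv, ?_⟩
    rw [h, mul_inv, inv_inv, FractionalIdeal.spanSingleton_inv, mul_comm]
  have hm0 : (m : FractionalIdeal (𝓞 F)⁰ F)⁻¹ ≠ 0 := by
    rw [hm]
    exact inv_ne_zero (mul_ne_zero (inv_ne_zero (ideleIdeal_ne_zero _))
      (FractionalIdeal.spanSingleton_ne_zero_iff.2 hμ.ne_zero))
  obtain rfl : ν' = ν := (ht _ hm0).unique (hinv hp hpm) (hinv hμ hm)
  -- With the same `ν`, two choices of `μ` differ by a unit, necessarily totally positive.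
  rw [hpm] at hm
  have hspan := mul_left_cancel₀ (inv_ne_zero (ideleIdeal_ne_zero (t ν'))) hm
  obtain ⟨ε, hε⟩ := FractionalIdeal.spanSingleton_eq_spanSingleton.1 hspan.symm
  have hε' : μ' = (ε : F) * μ := by rw [← hε, Units.smul_def, Algebra.smul_def]
  rw [hε', hf.compCoeff_unit_mul _ ε ((hε' ▸ hp : TotPos ((ε : F) * μ)).of_mul_right hμ)]

end Products

end

end HilbertModular

namespace HilbertModular

noncomputable section

/-! ### Arithmetic of real quadratic fields -/

section Quadratic

variable {F : Type*} [Field F] [NumberField F] [IsTotallyReal F]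

/-- A real quadratic field has exactly two infinite places. -/
lemma exists_two_places (hF : Module.finrank ℚ F = 2) :
    ∃ v w : InfinitePlace F, v ≠ w ∧ ∀ g : InfinitePlace F → ℝ,
      ∑ u, g u = g v + g w ∧ ∏ u, g u = g v * g w := by
  classical
  rw [← card_infinitePlace, ← Finset.card_univ, Finset.card_eq_two] at hF
  obtain ⟨v, w, hvw, h⟩ := hF
  exact ⟨v, w, hvw, fun g => by rw [h, Finset.sum_pair hvw, Finset.prod_pair hvw]; exact ⟨rfl, rfl⟩⟩

lemma trace_eq_sum (α : 𝓞 F) : (Algebra.trace ℤ (𝓞 F) α : ℝ) = ∑ v, realEmb v (α : F) := by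
  rw [sum_realEmb, ← Algebra.coe_trace_int]
  simp

lemma norm_eq_prod (α : 𝓞 F) : (Algebra.norm ℤ α : ℝ) = ∏ v, realEmb v (α : F) := by
  rw [prod_realEmb, ← Algebra.coe_norm_int]
  simp

omit [NumberField F] in
lemma realEmb_coe_injective (v : InfinitePlace F) :
    Function.Injective fun α : 𝓞 F => realEmb v (α : F) :=
  (realEmb v).injective.comp RingOfIntegers.coe_injective

/-- The characteristic equation, checked in `ℝ` through one real embedding. -/
lemma sq_eq_trace_mul_sub_norm (hF : Module.finrank ℚ F = 2) (α : 𝓞 F) :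
    α ^ 2 = (Algebra.trace ℤ (𝓞 F) α : 𝓞 F) * α - (Algebra.norm ℤ α : 𝓞 F) := by
  obtain ⟨v, w, -, h⟩ := exists_two_places hF
  apply realEmb_coe_injective v
  have h1 := trace_eq_sum α
  have h2 := norm_eq_prod α
  rw [(h _).1] at h1
  rw [(h _).2] at h2
  simp only [map_pow, map_sub, map_mul, map_intCast, h1, h2]
  ring

/-- If the discriminant of `α` is a square, then `α` is rational. -/
lemma two_mul_eq_trace (hF : Module.finrank ℚ F = 2) {α : 𝓞 F} {s : ℤ}
    (hs : Algebra.trace ℤ (𝓞 F) α ^ 2 - 4 * Algebra.norm ℤ α = s ^ 2) :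
    s = 0 ∧ 2 * α = (Algebra.trace ℤ (𝓞 F) α : 𝓞 F) := by
  obtain ⟨v, w, -, h⟩ := exists_two_places hF
  -- Here `(2α - T)² = s²`, so `2α = T ± s` is a rational integer `m`.
  have hsq := sq_eq_trace_mul_sub_norm hF α
  have hprod : (2 * α - (Algebra.trace ℤ (𝓞 F) α : 𝓞 F) - (s : 𝓞 F)) *
      (2 * α - (Algebra.trace ℤ (𝓞 F) α : 𝓞 F) + (s : 𝓞 F)) = 0 := by
    have hs' : (Algebra.trace ℤ (𝓞 F) α : 𝓞 F) ^ 2 - 4 * (Algebra.norm ℤ α : 𝓞 F) =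
        (s : 𝓞 F) ^ 2 := by exact_mod_cast congrArg (Int.cast : ℤ → 𝓞 F) hs
    linear_combination 4 * hsq + hs'
  obtain ⟨m, hm⟩ : ∃ m : ℤ, 2 * α = (m : 𝓞 F) := by
    rcases mul_eq_zero.1 hprod with h0 | h0
    · exact ⟨Algebra.trace ℤ (𝓞 F) α + s, by push_cast; linear_combination h0⟩
    · exact ⟨Algebra.trace ℤ (𝓞 F) α - s, by push_cast; linear_combination h0⟩
  have hreal : ∀ u : InfinitePlace F, 2 * realEmb u (α : F) = m := fun u => by
    have := congrArg (fun x : 𝓞 F => realEmb u (x : F)) hm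
    simpa only [map_mul, map_intCast, map_ofNat] using this
  -- Both embeddings of `α` equal `m/2`, so `T = m = 2α`, and this forces `s = 0`.
  have hT : Algebra.trace ℤ (𝓞 F) α = m := by
    have h1 := trace_eq_sum α
    rw [(h _).1] at h1
    have : (Algebra.trace ℤ (𝓞 F) α : ℝ) = m := by
      have := hreal v; have := hreal w
      linarith
    exact_mod_cast this
  refine ⟨?_, by rw [hT, hm]⟩
  have h0 : (s : 𝓞 F) ^ 2 = 0 := by
    rw [hT, hm] at hprod
    linear_combination -hprod
  exact_mod_cast pow_eq_zero_iff two_ne_zero |>.1 h0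

/-- The discriminant of `α` is the discriminant of the field times a square. -/
lemma exists_sq_mul_discr (hF : Module.finrank ℚ F = 2) (α : 𝓞 F) :
    ∃ i : ℤ, Algebra.trace ℤ (𝓞 F) α ^ 2 - 4 * Algebra.norm ℤ α = i ^ 2 * discr F := by
  obtain ⟨v, w, -, h⟩ := exists_two_places hF
  have hcard : Fintype.card (Module.Free.ChooseBasisIndex ℤ (𝓞 F)) = Fintype.card (Fin 2) := by
    rw [← Module.finrank_eq_card_basis (RingOfIntegers.basis F), RingOfIntegers.rank, hF,
      Fintype.card_fin]
  let e := Fintype.equivOfCardEq hcard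
  let B := (RingOfIntegers.basis F).reindex e
  let x : Fin 2 → 𝓞 F := ![1, α]
  -- Up to sign this is the index of `ℤ[α]` in `𝒪`, and zero when `α` is rational. The pair `(1, α)`
  -- has discriminant `T² - 4N`.
  refine ⟨(B.toMatrix x).det, ?_⟩
  have hB : Algebra.discr ℤ B = discr F := by
    rw [discr, Module.Basis.coe_reindex, Algebra.discr_reindex]
  have hx : Matrix.vecMul B ((B.toMatrix x).map (algebraMap ℤ (𝓞 F))) = x := by
    funext j
    rw [← B.sum_toMatrix_smul_self x j]
    simp only [Matrix.vecMul, dotProduct, Matrix.map_apply]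
    refine Finset.sum_congr rfl fun i _ => ?_
    rw [Algebra.smul_def, mul_comm]
  rw [← hB, ← Algebra.discr_of_matrix_vecMul, hx, Algebra.discr_def, Matrix.det_fin_two]
  have htr1 : Algebra.trace ℤ (𝓞 F) 1 = 2 := by
    have h1 := trace_eq_sum (1 : 𝓞 F)
    rw [(h _).1] at h1
    simp only [map_one] at h1
    norm_num at h1
    exact_mod_cast h1
  have htr2 : Algebra.trace ℤ (𝓞 F) (α * α) =
      Algebra.trace ℤ (𝓞 F) α ^ 2 - 2 * Algebra.norm ℤ α := by
    have h1 := trace_eq_sum (α * α)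
    have h2 := trace_eq_sum α
    have h3 := norm_eq_prod α
    rw [(h _).1] at h1 h2
    rw [(h _).2] at h3
    have : (Algebra.trace ℤ (𝓞 F) (α * α) : ℝ) =
        (Algebra.trace ℤ (𝓞 F) α : ℝ) ^ 2 - 2 * (Algebra.norm ℤ α : ℝ) := by
      rw [h1, h2, h3]
      simp only [map_mul]
      ring
    exact_mod_cast this
  simp only [Algebra.traceMatrix_apply, Algebra.traceForm_apply, x, Matrix.cons_val_zero,
    Matrix.cons_val_one, mul_one, one_mul, htr1, htr2]
  ring

/-- In `5 = i² · D` the square `i²` divides `5`, hence `i = ±1`. -/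
lemma discr_eq_five (hF : Module.finrank ℚ F = 2) {α : 𝓞 F}
    (h : Algebra.trace ℤ (𝓞 F) α ^ 2 - 4 * Algebra.norm ℤ α = 5) : discr F = 5 := by
  obtain ⟨i, hi⟩ := exists_sq_mul_discr hF α
  rw [h] at hi
  have hle : i ^ 2 ≤ 5 := Int.le_of_dvd (by norm_num) ⟨_, hi⟩
  have h1 : i ≤ 2 := by nlinarith
  have h2 : -2 ≤ i := by nlinarith
  interval_cases i <;> omega

/-- The inequalities satisfied by a totally positive integer `α` with `n - α` totally positive. -/
lemma trace_norm_bounds (hF : Module.finrank ℚ F = 2) {α : 𝓞 F} {n : ℕ} (h₁ : TotPos (α : F))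
    (h₂ : TotPos (((n : 𝓞 F) - α : 𝓞 F) : F)) :
    0 < Algebra.trace ℤ (𝓞 F) α ∧ Algebra.trace ℤ (𝓞 F) α < 2 * n ∧ 0 < Algebra.norm ℤ α ∧
      0 < (n : ℤ) ^ 2 - n * Algebra.trace ℤ (𝓞 F) α + Algebra.norm ℤ α ∧
      4 * Algebra.norm ℤ α ≤ Algebra.trace ℤ (𝓞 F) α ^ 2 := by
  obtain ⟨v, w, -, h⟩ := exists_two_places hF
  have hT := trace_eq_sum α
  have hN := norm_eq_prod α
  rw [(h _).1] at hT
  rw [(h _).2] at hN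
  have hv := h₁ v
  have hw := h₁ w
  have hv' := h₂ v
  have hw' := h₂ w
  simp only [RingOfIntegers.coe_eq_algebraMap (_ - _), map_sub, map_natCast] at hv' hw'
  -- With `x`, `y` the two embeddings of `α`, the bounds are `0 < x + y < 2n`, `0 < xy`, `0 < (n -
  -- x)(n - y)` and `0 ≤ (x - y)²`.
  refine ⟨?_, ?_, ?_, ?_, ?_⟩
  · have : (0 : ℝ) < Algebra.trace ℤ (𝓞 F) α := by rw [hT]; positivity
    exact_mod_cast this
  · have : (Algebra.trace ℤ (𝓞 F) α : ℝ) < 2 * n := by rw [hT]; linarith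
    exact_mod_cast this
  · have : (0 : ℝ) < Algebra.norm ℤ α := by rw [hN]; positivity
    exact_mod_cast this
  · have : (0 : ℝ) < (n : ℝ) ^ 2 - n * Algebra.trace ℤ (𝓞 F) α + Algebra.norm ℤ α := by
      rw [hT, hN]
      nlinarith [mul_pos hv' hw']
    exact_mod_cast this
  · have : 4 * (Algebra.norm ℤ α : ℝ) ≤ (Algebra.trace ℤ (𝓞 F) α : ℝ) ^ 2 := by
      rw [hT, hN]
      nlinarith [sq_nonneg (realEmb v (α : F) - realEmb w (α : F))]
    exact_mod_cast this

omit [IsTotallyReal F] in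
lemma eq_of_two_mul_eq {α : 𝓞 F} {m : ℕ} (h : 2 * α = ((2 * m : ℤ) : 𝓞 F)) : α = m := by
  have : (2 : 𝓞 F) ≠ 0 := two_ne_zero
  apply mul_left_cancel₀ this
  rw [h]
  push_cast
  ring

/-- The bounds leave `T = 1`, and then `4N ≤ 1` contradicts `0 < N`. -/
lemma not_totPos_one_sub (hF : Module.finrank ℚ F = 2) {α : 𝓞 F} (h₁ : TotPos (α : F)) :
    ¬ TotPos ((1 - α : 𝓞 F) : F) := by
  intro h₂
  obtain ⟨a, b, c, d, e⟩ := trace_norm_bounds hF (n := 1) h₁ (by rwa [Nat.cast_one])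
  generalize Algebra.trace ℤ (𝓞 F) α = T at *
  generalize Algebra.norm ℤ α = N at *
  have : T = 1 := by push_cast at b; omega
  subst this
  omega

/-- Only `T = 2`, `N = 1` meets the bounds; its discriminant is zero, so `α = 1`. -/
lemma eq_of_totPos_two_sub (hF : Module.finrank ℚ F = 2) {α : 𝓞 F} (h₁ : TotPos (α : F))
    (h₂ : TotPos ((2 - α : 𝓞 F) : F)) : α = 1 := by
  obtain ⟨a, b, c, d, e⟩ := trace_norm_bounds hF (n := 2) h₁ (by rwa [Nat.cast_ofNat])
  have hs := fun s => two_mul_eq_trace hF (α := α) (s := s)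
  generalize Algebra.trace ℤ (𝓞 F) α = T at *
  generalize Algebra.norm ℤ α = N at *
  push_cast at b d
  have hT : T < 4 := by omega
  interval_cases T
  · omega
  · have := (hs 0 (by omega)).2
    simpa using eq_of_two_mul_eq (m := 1) (by simpa using this)
  · omega

/-- The decompositions of `3`. -/
lemma cases_of_totPos_three_sub (hF : Module.finrank ℚ F = 2) {α : 𝓞 F} (h₁ : TotPos (α : F))
    (h₂ : TotPos ((3 - α : 𝓞 F) : F)) :
    α = 1 ∨ α = 2 ∨ (discr F = 5 ∧ α ^ 2 = 3 * α - 1) := by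
  obtain ⟨a, b, c, d, e⟩ := trace_norm_bounds hF (n := 3) h₁ (by rwa [Nat.cast_ofNat])
  have hs := fun s => two_mul_eq_trace hF (α := α) (s := s)
  have hq := sq_eq_trace_mul_sub_norm hF α
  have hD := discr_eq_five hF (α := α)
  generalize Algebra.trace ℤ (𝓞 F) α = T at *
  generalize Algebra.norm ℤ α = N at *
  push_cast at b d
  have hT : T < 6 := by omega
  interval_cases T
  · omega
  · have := (hs 0 (by omega)).2
    exact Or.inl (by simpa using eq_of_two_mul_eq (m := 1) (by simpa using this))
  -- Trace `3`: `N = 1` has discriminant `5`, while `N = 2` has discriminant `1`, a nonzero square.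
  · have hN : N < 3 := by omega
    interval_cases N
    · exact Or.inr (Or.inr ⟨hD (by norm_num), by simpa using hq⟩)
    · exact absurd (hs 1 (by norm_num)).1 one_ne_zero
  · have := (hs 0 (by omega)).2
    exact Or.inr (Or.inl (by simpa using eq_of_two_mul_eq (m := 2) (by simpa using this)))
  · omega

/-- The decompositions of `4` when `2` is inert. -/
lemma cases_of_totPos_four_sub (hF : Module.finrank ℚ F = 2)
    (hinert : (Ideal.span {2} : Ideal (𝓞 F)).IsPrime) {α : 𝓞 F} (h₁ : TotPos (α : F))
    (h₂ : TotPos ((4 - α : 𝓞 F) : F)) :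
    α = 1 ∨ α = 2 ∨ α = 3 ∨
      (discr F = 5 ∧ (α ^ 2 = 3 * α - 1 ∨ (4 - α) ^ 2 = 3 * (4 - α) - 1)) := by
  obtain ⟨a, b, c, d, e⟩ := trace_norm_bounds hF (n := 4) h₁ (by rwa [Nat.cast_ofNat])
  have hs := fun s => two_mul_eq_trace hF (α := α) (s := s)
  have hq := sq_eq_trace_mul_sub_norm hF α
  have hD := discr_eq_five hF (α := α)
  have h2 : (2 : 𝓞 F) ≠ 0 := two_ne_zero
  have hone : ∀ x : 𝓞 F, 2 * x ≠ 1 := fun x hx =>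
    hinert.ne_top (Ideal.eq_top_of_isUnit_mem _ (Ideal.mem_span_singleton_self 2)
      (IsUnit.of_mul_eq_one x hx))
  generalize Algebra.trace ℤ (𝓞 F) α = T at *
  generalize Algebra.norm ℤ α = N at *
  push_cast at b d
  have hT : T < 8 := by omega
  interval_cases T
  · omega
  · have := (hs 0 (by omega)).2
    exact Or.inl (by simpa using eq_of_two_mul_eq (m := 1) (by simpa using this))
  · have hN : N < 3 := by omega
    interval_cases N
    · exact Or.inr (Or.inr (Or.inr ⟨hD (by norm_num), Or.inl (by simpa using hq)⟩))
    · exact absurd (hs 1 (by norm_num)).1 one_ne_zero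
  · have hN : N < 5 := by omega
    interval_cases N
    -- Discriminant `12`: here `(α - 1)² = 2α`, so inertness gives `α - 1 = 2y`, and the equation
    -- reduces to `2(y² - y) = 1`, making `2` a unit.
    · exfalso
      push_cast at hq
      obtain ⟨y, hy⟩ := Ideal.mem_span_singleton'.1 (hinert.mem_of_pow_mem 2
        (Ideal.mem_span_singleton'.2 ⟨α, by linear_combination -hq⟩ :
          (α - 1) ^ 2 ∈ Ideal.span {(2 : 𝓞 F)}))
      refine hone (y ^ 2 - y) (mul_left_cancel₀ h2 ?_)
      linear_combination (2 * y - 2 + α - 1) * hy + hq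
    -- Discriminant `8`: here `α² = 2(2α - 1)`, so `α = 2y` and `2(2y - y²) = 1`.
    · exfalso
      push_cast at hq
      obtain ⟨y, hy⟩ := Ideal.mem_span_singleton'.1 (hinert.mem_of_pow_mem 2
        (Ideal.mem_span_singleton'.2 ⟨2 * α - 1, by linear_combination -hq⟩ :
          α ^ 2 ∈ Ideal.span {(2 : 𝓞 F)}))
      refine hone (2 * y - y ^ 2) (mul_left_cancel₀ h2 ?_)
      linear_combination (4 - 2 * y - α) * hy - hq
    · exact absurd (hs 2 (by norm_num)).1 two_ne_zero
    · have := (hs 0 (by norm_num)).2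
      exact Or.inr (Or.inl (by simpa using eq_of_two_mul_eq (m := 2) (by simpa using this)))
  · have hN : N < 7 := by omega
    have hN' : 4 < N := by omega
    interval_cases N
    · refine Or.inr (Or.inr (Or.inr ⟨hD (by norm_num), Or.inr ?_⟩))
      push_cast at hq
      linear_combination hq
    · exact absurd (hs 1 (by norm_num)).1 one_ne_zero
  · have := (hs 0 (by omega)).2
    exact Or.inr (Or.inr (Or.inl
      (by simpa using eq_of_two_mul_eq (m := 3) (by simpa using this))))
  · omega

/-- The field of discriminant `5` contains the square of the golden ratio. -/
lemma exists_golden (hF : Module.finrank ℚ F = 2) (hD : discr F = 5) :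
    ∃ η : 𝓞 F, η ^ 2 = 3 * η - 1 := by
  obtain ⟨v, w, hvw, h⟩ := exists_two_places hF
  -- Some integer separates the two real embeddings, since `F` is the fraction field of `𝒪`.
  obtain ⟨x, hx⟩ : ∃ x : 𝓞 F, realEmb v (x : F) ≠ realEmb w (x : F) := by
    by_contra! hall
    apply hvw
    have : realEmb v = realEmb w := by
      ext a
      obtain ⟨n, d, -, rfl⟩ := IsFractionRing.div_surjective (A := 𝓞 F) a
      rw [map_div₀, map_div₀, hall, hall]
    rw [← InfinitePlace.mk_embedding v, ← InfinitePlace.mk_embedding w]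
    congr 1
    ext a
    rw [← coe_realEmb, ← coe_realEmb, this]
  obtain ⟨i, hi⟩ := exists_sq_mul_discr hF x
  have hsq := sq_eq_trace_mul_sub_norm hF x
  have hT := trace_eq_sum x
  have hN := norm_eq_prod x
  rw [(h _).1] at hT
  rw [(h _).2] at hN
  have hi0 : i ≠ 0 := by
    rintro rfl
    have : (Algebra.trace ℤ (𝓞 F) x : ℝ) ^ 2 - 4 * Algebra.norm ℤ x = 0 := by
      have := congrArg (Int.cast : ℤ → ℝ) hi
      push_cast at this
      simpa using this
    rw [hT, hN] at this
    have h0 : (realEmb v (x : F) - realEmb w (x : F)) ^ 2 = 0 := by linear_combination this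
    exact hx (sub_eq_zero.1 (pow_eq_zero_iff two_ne_zero |>.1 h0))
  have hiF : (i : F) ≠ 0 := Int.cast_ne_zero.2 hi0
  -- A square root of `5`, because `(2x - T)² = T² - 4N = 5i²`.
  let δ : F := (2 * (x : F) - (Algebra.trace ℤ (𝓞 F) x : F)) / i
  have hδ : δ ^ 2 = 5 := by
    have e1 : (x : F) ^ 2 = (Algebra.trace ℤ (𝓞 F) x : F) * x - (Algebra.norm ℤ x : F) := by
      have := congrArg (algebraMap (𝓞 F) F) hsq
      simpa using this
    have e2 : (Algebra.trace ℤ (𝓞 F) x : F) ^ 2 - 4 * (Algebra.norm ℤ x : F) = (i : F) ^ 2 * 5 := by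
      rw [hD] at hi
      have := congrArg (Int.cast : ℤ → F) hi
      push_cast at this
      exact this
    rw [div_pow, div_eq_iff (pow_ne_zero 2 hiF)]
    linear_combination 4 * e1 + e2
  have hη : ((3 + δ) / 2) ^ 2 = 3 * ((3 + δ) / 2) - 1 := by
    linear_combination hδ / 4
  have hint : IsIntegral ℤ ((3 + δ) / 2) := by
    refine ⟨Polynomial.X ^ 2 - 3 * Polynomial.X + 1, by monicity!, ?_⟩
    simp [hη]
  obtain ⟨η, hη'⟩ : ∃ η : 𝓞 F, (η : F) = (3 + δ) / 2 := ⟨⟨(3 + δ) / 2, hint⟩, rfl⟩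
  refine ⟨η, ?_⟩
  apply RingOfIntegers.coe_injective
  rw [← hη'] at hη
  rw [map_pow, map_sub, map_mul, map_ofNat, map_one, hη]

end Quadratic

end

end HilbertModular

namespace HilbertModular

noncomputable section

/-! ### Units and the different in discriminant five -/

section Golden

variable {F : Type*} [Field F] [NumberField F] {η : 𝓞 F}

/-- In each embedding `η` and `3 - η` have product `1` and sum `3`, so both are positive. -/
lemma golden_totPos [IsTotallyReal F] (hη : η ^ 2 = 3 * η - 1) :
    TotPos (η : F) ∧ TotPos ((3 - η : 𝓞 F) : F) := by
  have h : ∀ v : InfinitePlace F, realEmb v (η : F) * (3 - realEmb v (η : F)) = 1 := fun v => by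
    have := congrArg (fun x : 𝓞 F => realEmb v (x : F)) hη
    simp only [map_pow, map_sub, map_mul, map_ofNat, map_one] at this
    linear_combination -this
  refine ⟨fun v => ?_, fun v => ?_⟩
  · by_contra! hle
    nlinarith [h v]
  · rw [RingOfIntegers.coe_eq_algebraMap (3 - η), map_sub, map_sub, map_ofNat, map_ofNat]
    by_contra! hle
    nlinarith [h v]

omit [NumberField F] in
lemma span_golden (hη : η ^ 2 = 3 * η - 1) : Ideal.span {η} = ⊤ ∧ Ideal.span {3 - η} = ⊤ := by
  rw [Ideal.span_singleton_eq_top, Ideal.span_singleton_eq_top]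
  exact ⟨IsUnit.of_mul_eq_one (3 - η) (by linear_combination -hη),
    IsUnit.of_mul_eq_one η (by linear_combination -hη)⟩

omit [NumberField F] in
-- `(4 - η)η = 1 + η`, and `η` is a unit with inverse `3 - η`.
lemma span_four_sub_golden (hη : η ^ 2 = 3 * η - 1) :
    Ideal.span {4 - η} = Ideal.span {1 + η} := by
  rw [Ideal.span_singleton_eq_span_singleton]
  refine ⟨Units.mk η (3 - η) (by linear_combination -hη) (by linear_combination -hη), ?_⟩
  change (4 - η) * η = 1 + η
  linear_combination -hη

lemma absNorm_span_natCast (n : ℕ) :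
    Ideal.absNorm (Ideal.span {(n : 𝓞 F)}) = n ^ Module.finrank ℚ F := by
  rw [Ideal.absNorm_span_singleton, ← map_natCast (algebraMap ℤ (𝓞 F)) n, Algebra.norm_algebraMap,
    RingOfIntegers.rank, Int.natAbs_pow, Int.natAbs_natCast]

/-- The different of the field of discriminant `5`. -/
lemma different_eq_span (hF : Module.finrank ℚ F = 2) (hD : discr F = 5)
    (hη : η ^ 2 = 3 * η - 1) : different F = Ideal.span {1 + η} := by
  have hnorm : Ideal.absNorm (different F) = 5 := by
    rw [different, NumberField.absNorm_differentIdeal F, hD]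
    rfl
  -- The relation for `η` gives `(1 + η)² = 5η`, which is `5` up to a unit.
  have hsq : Ideal.span {1 + η} ^ 2 = Ideal.span {((5 : ℕ) : 𝓞 F)} := by
    rw [Ideal.span_singleton_pow, Ideal.span_singleton_eq_span_singleton]
    refine ⟨Units.mk (3 - η) η (by linear_combination -hη) (by linear_combination -hη), ?_⟩
    change (1 + η) ^ 2 * (3 - η) = ((5 : ℕ) : 𝓞 F)
    push_cast
    linear_combination (-2 - η) * hη
  have hnormJ : Ideal.absNorm (Ideal.span {1 + η}) = 5 := by
    have := congrArg Ideal.absNorm hsq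
    rw [map_pow, absNorm_span_natCast, hF] at this
    exact Nat.pow_left_injective two_ne_zero this
  -- The different has norm `5`, so it is prime and contains `5`. It therefore divides `(5) = (1 +
  -- η)²`, hence `(1 + η)`, and the norms agree.
  have hprime : Prime (different F) := by
    have hp : (different F).IsPrime := Ideal.isPrime_of_irreducible_absNorm
      (hnorm ▸ Nat.prime_five)
    exact Ideal.prime_of_isPrime differentIdeal_ne_bot hp
  have hdvd : different F ∣ Ideal.span {1 + η} := by
    refine hprime.dvd_of_dvd_pow (n := 2) ?_
    rw [hsq, Ideal.dvd_span_singleton, ← hnorm]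
    exact Ideal.absNorm_mem _
  obtain ⟨K, hK⟩ := hdvd
  have hK1 : Ideal.absNorm K = 1 := by
    have := congrArg Ideal.absNorm hK
    rw [map_mul, hnorm, hnormJ] at this
    omega
  rw [hK, Ideal.absNorm_eq_one_iff.1 hK1, Ideal.mul_top]

end Golden

/-! ### Coefficients of products at principal ideals and at primes of norm two -/

section Coefficients

variable {F : Type*} [Field F] [NumberField F] [IsTotallyReal F]
  {N : Type*} {t : N → (FinAdeles F)ˣ} {ν₁ : N}

lemma exists_generator (hν₁ : NarrowEquiv 1 (ideleIdeal (t ν₁))) :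
    ∃ μ : F, TotPos μ ∧ ideleIdeal (t ν₁) = FractionalIdeal.spanSingleton (𝓞 F)⁰ μ := by
  obtain ⟨a, ha, h⟩ := hν₁
  refine ⟨a⁻¹, ha.inv, ?_⟩
  rw [← FractionalIdeal.spanSingleton_inv]
  exact eq_inv_of_mul_eq_one_right h.symm

/-- With `t₁𝒪 = (μ)` one has `(α) = t₁⁻¹(αμ)`, so a totally positive `α` stands for the Fourier
index `αμ`. -/
lemma coeff_span (ht : IsNarrowRepSystem F t) {k : ℤ} {f : GL (Fin 2) (Adeles F) → ℂ}
    (hf : IsModularForm k f) {μ : F} (hμ : TotPos μ)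
    (hν₁ : ideleIdeal (t ν₁) = FractionalIdeal.spanSingleton (𝓞 F)⁰ μ) {α : 𝓞 F}
    (hα : TotPos (α : F)) :
    coeff t k f (Ideal.span {α}) =
      normFactor k (t ν₁) * compCoeff k f (t ν₁) ((α : F) * μ) := by
  refine coeff_eq ht hf (hα.mul hμ) ?_
  rw [hν₁, FractionalIdeal.coeIdeal_span_singleton, FractionalIdeal.spanSingleton_inv,
    FractionalIdeal.spanSingleton_mul_spanSingleton, mul_comm _ μ,
    inv_mul_cancel_left₀ hμ.ne_zero]

/-- The coefficient of a product at a principal ideal with a totally positive generator. -/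
theorem coeff_span_mul (hF : Module.finrank ℚ F = 2) (ht : IsNarrowRepSystem F t)
    (hν₁ : NarrowEquiv 1 (ideleIdeal (t ν₁))) {k₁ k₂ : ℤ}
    {f h : GL (Fin 2) (Adeles F) → ℂ} (hf : IsModularForm k₁ f) (hh : IsModularForm k₂ h)
    {n : 𝓞 F} (hn : TotPos (n : F)) (S : Finset (𝓞 F))
    (hS : ∀ α : 𝓞 F, α ∈ S ↔ TotPos (α : F) ∧ TotPos ((n - α : 𝓞 F) : F)) :
    coeff t (k₁ + k₂) (f * h) (Ideal.span {n}) =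
      constCoeff k₂ h (t ν₁) * coeff t k₁ f (Ideal.span {n}) +
      constCoeff k₁ f (t ν₁) * coeff t k₂ h (Ideal.span {n}) +
      ∑ α ∈ S, coeff t k₁ f (Ideal.span {α}) * coeff t k₂ h (Ideal.span {n - α}) := by
  classical
  obtain ⟨μ, hμ, hgen⟩ := exists_generator hν₁
  -- Since `t₁𝒪 = (μ)`, the lattice condition on `αμ` says that `α` is integral; decompositions in
  -- `F` thus become decompositions in `𝒪`.
  have hmem : ∀ α : F, α * μ ∈ ideleIdeal (t ν₁) → ∃ β : 𝓞 F, (β : F) = α := by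
    intro α hα
    rw [hgen, FractionalIdeal.mem_spanSingleton] at hα
    obtain ⟨β, hβ⟩ := hα
    rw [Algebra.smul_def] at hβ
    exact ⟨β, mul_right_cancel₀ hμ.ne_zero hβ⟩
  have hsub : ∀ β : 𝓞 F, ((n - β : 𝓞 F) : F) = n - β := fun β => map_sub (algebraMap (𝓞 F) F) n β
  have hinj : Function.Injective fun α : 𝓞 F => (α : F) := RingOfIntegers.coe_injective
  have key := compCoeff_mul_of_totPos (by omega) hf hh (t ν₁) hn hμ (S.image fun α : 𝓞 F => (α : F))
    (fun α hα => by
      obtain ⟨β, hβ, rfl⟩ := Finset.mem_image.1 hα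
      obtain ⟨p₁, p₂⟩ := (hS β).1 hβ
      rw [hsub] at p₂
      exact ⟨p₁, p₂⟩)
    (fun α h₁ _ p₁ p₂ => by
      obtain ⟨β, rfl⟩ := hmem α h₁
      exact Finset.mem_image_of_mem _ ((hS β).2 ⟨p₁, by rwa [hsub]⟩))
  rw [Finset.sum_image fun x _ y _ hxy => hinj hxy] at key
  have hsum : ∑ α ∈ S, coeff t k₁ f (Ideal.span {α}) * coeff t k₂ h (Ideal.span {n - α}) =
      normFactor k₁ (t ν₁) * normFactor k₂ (t ν₁) *
        ∑ α ∈ S, compCoeff k₁ f (t ν₁) ((α : F) * μ) *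
          compCoeff k₂ h (t ν₁) (((n : F) - α) * μ) := by
    rw [Finset.mul_sum]
    refine Finset.sum_congr rfl fun α hα => ?_
    obtain ⟨p₁, p₂⟩ := (hS α).1 hα
    rw [coeff_span ht hf hμ hgen p₁, coeff_span ht hh hμ hgen p₂, hsub]
    ring
  rw [hsum, coeff_span ht (hf.mul hh) hμ hgen hn, coeff_span ht hf hμ hgen hn,
    coeff_span ht hh hμ hgen hn, key, normFactor_add, constCoeff, constCoeff]
  ring

omit [IsTotallyReal F] in
/-- A prime in a decomposition of `2` has norm two. -/
lemma absNorm_eq_two (hF : Module.finrank ℚ F = 2) {p : Ideal (𝓞 F)} (hp : p.IsPrime)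
    (h : Ideal.span {2} = p ^ 2 ∨ ∃ q : Ideal (𝓞 F), q.IsPrime ∧ q ≠ p ∧ Ideal.span {2} = p * q) :
    Ideal.absNorm p = 2 := by
  have h4 : Ideal.absNorm (Ideal.span {(2 : 𝓞 F)}) = 4 := by
    have := absNorm_span_natCast (F := F) 2
    rw [hF] at this
    simpa using this
  have h1 : ∀ {q : Ideal (𝓞 F)}, q.IsPrime → Ideal.absNorm q ≠ 1 := fun hq h =>
    hq.ne_top (Ideal.absNorm_eq_one_iff.1 h)
  obtain ⟨q, hq, he⟩ : ∃ q : Ideal (𝓞 F), q.IsPrime ∧ Ideal.span {2} = p * q := by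
    rcases h with h | ⟨q, hq, -, h⟩
    · exact ⟨p, hp, by rw [h, sq]⟩
    · exact ⟨q, hq, h⟩
  rw [he, map_mul] at h4
  have hp1 := h1 hp
  have hq1 := h1 hq
  generalize Ideal.absNorm p = a at *
  generalize Ideal.absNorm q = b at *
  have ha : a ≤ 4 := Nat.le_of_dvd (by norm_num) ⟨b, h4.symm⟩
  interval_cases a <;> omega

/-- Multiplication by `α` preserves integrality of `p` only if `N(α) N(p) ≥ 1`. -/
lemma one_le_prod_mul_absNorm {p : Ideal (𝓞 F)} (hp : p ≠ ⊥) {α : F} (hα : TotPos α)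
    (hint : FractionalIdeal.spanSingleton (𝓞 F)⁰ α * (p : FractionalIdeal (𝓞 F)⁰ F) ≤ 1) :
    1 ≤ (∏ v, realEmb v α) * Ideal.absNorm p := by
  obtain ⟨J, hJ⟩ := FractionalIdeal.le_one_iff_exists_coeIdeal.1 hint
  have hJ0 : J ≠ ⊥ := by
    rintro rfl
    rw [FractionalIdeal.coeIdeal_bot] at hJ
    exact mul_ne_zero (FractionalIdeal.spanSingleton_ne_zero_iff.2 hα.ne_zero)
      (FractionalIdeal.coeIdeal_ne_zero.2 hp) hJ.symm
  have hn := congrArg FractionalIdeal.absNorm hJ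
  rw [map_mul, FractionalIdeal.coeIdeal_absNorm, FractionalIdeal.coeIdeal_absNorm,
    FractionalIdeal.absNorm_span_singleton] at hn
  have hn' : ((Ideal.absNorm J : ℕ) : ℝ) = |(Algebra.norm ℚ α : ℝ)| * Ideal.absNorm p := by
    exact_mod_cast congrArg (Rat.cast : ℚ → ℝ) hn
  rw [← prod_realEmb, abs_of_pos (Finset.prod_pos fun v _ => hα v)] at hn'
  rw [← hn']
  exact_mod_cast Nat.one_le_iff_ne_zero.2 fun h => hJ0 (Ideal.absNorm_eq_zero_iff.1 h)

/-- The coefficient of a product at an ideal of norm two. -/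
theorem coeff_mul_of_absNorm_eq_two (hF : Module.finrank ℚ F = 2) (ht : IsNarrowRepSystem F t)
    {k₁ k₂ : ℤ} {f h : GL (Fin 2) (Adeles F) → ℂ} (hf : IsModularForm k₁ f)
    (hh : IsModularForm k₂ h) {p : Ideal (𝓞 F)} (hp : Ideal.absNorm p = 2) {ν : N}
    (hν : NarrowEquiv (p : FractionalIdeal (𝓞 F)⁰ F) (ideleIdeal (t ν))⁻¹) :
    coeff t (k₁ + k₂) (f * h) p =
      constCoeff k₂ h (t ν) * coeff t k₁ f p + constCoeff k₁ f (t ν) * coeff t k₂ h p := by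
  obtain ⟨a, ha, hpa⟩ := hν
  have hm := hpa
  rw [mul_comm] at hm
  have hp0 : p ≠ ⊥ := by
    rintro rfl
    simp at hp
  have hle : ∀ α : F, α * a ∈ ideleIdeal (t ν) →
      FractionalIdeal.spanSingleton (𝓞 F)⁰ α * (p : FractionalIdeal (𝓞 F)⁰ F) ≤ 1 := by
    intro α hα
    rw [hpa, ← mul_assoc, FractionalIdeal.spanSingleton_mul_spanSingleton,
      ← mul_inv_cancel₀ (ideleIdeal_ne_zero (t ν))]
    exact mul_le_mul_left (FractionalIdeal.spanSingleton_le_iff_mem.2 hα) _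
  obtain ⟨v, w, -, hvw⟩ := exists_two_places hF
  have key := compCoeff_mul_of_totPos (n := 1) (by omega) hf hh (t ν)
    (by simpa using totPos_natCast (F := F) one_pos) ha ∅ (by simp) (fun α h₁ h₂ p₁ p₂ => by
      exfalso
      -- Both norms are at least `1/2`. With `x`, `y` the embeddings of `α`, however, `xy + (1 -
      -- x)(1 - y) = 1 - x(1 - y) - y(1 - x) < 1`.
      have b₁ := one_le_prod_mul_absNorm hp0 p₁ (hle _ h₁)
      have b₂ := one_le_prod_mul_absNorm hp0 p₂ (hle _ h₂)
      rw [(hvw _).2, hp] at b₁ b₂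
      simp only [map_sub, map_one] at b₂
      push_cast at b₁ b₂
      have x₁ := p₁ v
      have y₁ := p₁ w
      have x₂ := p₂ v
      have y₂ := p₂ w
      simp only [map_sub, map_one] at x₂ y₂
      generalize realEmb v α = x at *
      generalize realEmb w α = y at *
      nlinarith [mul_pos x₁ y₂, mul_pos y₁ x₂])
  rw [one_mul, Finset.sum_empty, add_zero] at key
  rw [coeff_eq ht (hf.mul hh) ha hm, coeff_eq ht hf ha hm, coeff_eq ht hh ha hm, key,
    normFactor_add, constCoeff, constCoeff]
  ring

end Coefficients

end

end HilbertModular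

namespace HilbertModular

noncomputable section

/-! ### Totally positive decompositions of 2, 3 and 4 -/

section Decompositions

variable {F : Type*} [Field F] [NumberField F] [IsTotallyReal F] {η : 𝓞 F}

omit [IsTotallyReal F] in
-- Each equality contradicts the quadratic relation in characteristic zero. Together these
-- exclusions keep the elements listed in the golden decompositions distinct, so that no term of the
-- sums is lost.
lemma golden_ne (hη : η ^ 2 = 3 * η - 1) :
    η ≠ 0 ∧ η ≠ 1 ∧ η ≠ 2 ∧ η ≠ 3 ∧ 2 * η ≠ 3 := by
  refine ⟨?_, ?_, ?_, ?_, fun h => ?_⟩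
  · rintro rfl; norm_num at hη
  · rintro rfl; norm_num at hη
  · rintro rfl; norm_num at hη
  · rintro rfl; norm_num at hη
  · have : (5 : 𝓞 F) = 0 := by linear_combination (-4) * hη + (2 * η - 3) * h
    norm_num at this

omit [NumberField F] [IsTotallyReal F] in
-- `η` and `3 - η` are the two roots of `X² - 3X + 1`.
lemma golden_cases (hη : η ^ 2 = 3 * η - 1) {α : 𝓞 F} (hα : α ^ 2 = 3 * α - 1) :
    α = η ∨ α = 3 - η := by
  have : (α - η) * (α - (3 - η)) = 0 := by linear_combination hα - hη
  rcases mul_eq_zero.1 this with h | h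
  · exact Or.inl (sub_eq_zero.1 h)
  · exact Or.inr (sub_eq_zero.1 h)

omit [NumberField F] in
lemma totPos_one : TotPos ((1 : 𝓞 F) : F) := by
  have := totPos_natCast (F := F) one_pos
  rw [RingOfIntegers.coe_eq_algebraMap, map_one]
  rwa [Nat.cast_one] at this

omit [NumberField F] in
lemma totPos_ofNat (n : ℕ) [n.AtLeastTwo] : TotPos ((OfNat.ofNat n : 𝓞 F) : F) := by
  have := totPos_natCast (F := F) (n := OfNat.ofNat n) (NeZero.pos n)
  rw [RingOfIntegers.coe_eq_algebraMap, map_ofNat]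
  rwa [Nat.cast_ofNat] at this

lemma mem_decomp_two (hF : Module.finrank ℚ F = 2) (α : 𝓞 F) :
    α ∈ ({1} : Finset (𝓞 F)) ↔ TotPos (α : F) ∧ TotPos ((2 - α : 𝓞 F) : F) := by
  rw [Finset.mem_singleton]
  constructor
  · rintro rfl
    rw [show (2 : 𝓞 F) - 1 = 1 by norm_num]
    exact ⟨totPos_one, totPos_one⟩
  · rintro ⟨h₁, h₂⟩
    exact eq_of_totPos_two_sub hF h₁ h₂

open Classical in
/-- The totally positive `α` with `3 - α` totally positive. -/
lemma mem_decomp_three (hF : Module.finrank ℚ F = 2) (hD : discr F ≠ 5) (α : 𝓞 F) :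
    α ∈ ({1, 2} : Finset (𝓞 F)) ↔ TotPos (α : F) ∧ TotPos ((3 - α : 𝓞 F) : F) := by
  rw [Finset.mem_insert, Finset.mem_singleton]
  constructor
  · rintro (rfl | rfl)
    · rw [show (3 : 𝓞 F) - 1 = 2 by norm_num]
      exact ⟨totPos_one, totPos_ofNat 2⟩
    · rw [show (3 : 𝓞 F) - 2 = 1 by norm_num]
      exact ⟨totPos_ofNat 2, totPos_one⟩
  · rintro ⟨h₁, h₂⟩
    rcases cases_of_totPos_three_sub hF h₁ h₂ with h | h | h
    · exact Or.inl h
    · exact Or.inr h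
    · exact absurd h.1 hD

open Classical in
lemma mem_decomp_three_golden (hF : Module.finrank ℚ F = 2) (hη : η ^ 2 = 3 * η - 1) (α : 𝓞 F) :
    α ∈ ({1, 2, η, 3 - η} : Finset (𝓞 F)) ↔
      TotPos (α : F) ∧ TotPos ((3 - α : 𝓞 F) : F) := by
  obtain ⟨g₁, g₂⟩ := golden_totPos hη
  simp only [Finset.mem_insert, Finset.mem_singleton]
  constructor
  · rintro (rfl | rfl | rfl | rfl)
    · rw [show (3 : 𝓞 F) - 1 = 2 by norm_num]
      exact ⟨totPos_one, totPos_ofNat 2⟩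
    · rw [show (3 : 𝓞 F) - 2 = 1 by norm_num]
      exact ⟨totPos_ofNat 2, totPos_one⟩
    · exact ⟨g₁, g₂⟩
    · rw [sub_sub_cancel]
      exact ⟨g₂, g₁⟩
  · rintro ⟨h₁, h₂⟩
    rcases cases_of_totPos_three_sub hF h₁ h₂ with h | h | h
    · exact Or.inl h
    · exact Or.inr (Or.inl h)
    · exact Or.inr (Or.inr (golden_cases hη h.2))

open Classical in
/-- The totally positive `α` with `4 - α` totally positive, when `2` is inert. -/
lemma mem_decomp_four (hF : Module.finrank ℚ F = 2)
    (hinert : (Ideal.span {2} : Ideal (𝓞 F)).IsPrime) (hD : discr F ≠ 5) (α : 𝓞 F) :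
    α ∈ ({1, 2, 3} : Finset (𝓞 F)) ↔ TotPos (α : F) ∧ TotPos ((4 - α : 𝓞 F) : F) := by
  simp only [Finset.mem_insert, Finset.mem_singleton]
  constructor
  · rintro (rfl | rfl | rfl)
    · rw [show (4 : 𝓞 F) - 1 = 3 by norm_num]
      exact ⟨totPos_one, totPos_ofNat 3⟩
    · rw [show (4 : 𝓞 F) - 2 = 2 by norm_num]
      exact ⟨totPos_ofNat 2, totPos_ofNat 2⟩
    · rw [show (4 : 𝓞 F) - 3 = 1 by norm_num]
      exact ⟨totPos_ofNat 3, totPos_one⟩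
  · rintro ⟨h₁, h₂⟩
    rcases cases_of_totPos_four_sub hF hinert h₁ h₂ with h | h | h | h
    · exact Or.inl h
    · exact Or.inr (Or.inl h)
    · exact Or.inr (Or.inr h)
    · exact absurd h.1 hD

open Classical in
-- The irrational decompositions are `η + (4 - η)` and `(3 - η) + (1 + η)`, each a unit plus a
-- generator of the different.
lemma mem_decomp_four_golden (hF : Module.finrank ℚ F = 2)
    (hinert : (Ideal.span {2} : Ideal (𝓞 F)).IsPrime) (hη : η ^ 2 = 3 * η - 1) (α : 𝓞 F) :
    α ∈ ({1, 2, 3, η, 3 - η, 4 - η, 1 + η} : Finset (𝓞 F)) ↔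
      TotPos (α : F) ∧ TotPos ((4 - α : 𝓞 F) : F) := by
  obtain ⟨g₁, g₂⟩ := golden_totPos hη
  have g₃ : TotPos ((1 + η : 𝓞 F) : F) := by
    rw [RingOfIntegers.coe_eq_algebraMap, map_add]
    exact totPos_one.add g₁
  have g₄ : TotPos ((4 - η : 𝓞 F) : F) := by
    rw [show 4 - η = 1 + (3 - η) by ring, RingOfIntegers.coe_eq_algebraMap, map_add]
    exact totPos_one.add g₂
  simp only [Finset.mem_insert, Finset.mem_singleton]
  constructor
  · rintro (rfl | rfl | rfl | rfl | rfl | rfl | rfl)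
    · rw [show (4 : 𝓞 F) - 1 = 3 by norm_num]
      exact ⟨totPos_one, totPos_ofNat 3⟩
    · rw [show (4 : 𝓞 F) - 2 = 2 by norm_num]
      exact ⟨totPos_ofNat 2, totPos_ofNat 2⟩
    · rw [show (4 : 𝓞 F) - 3 = 1 by norm_num]
      exact ⟨totPos_ofNat 3, totPos_one⟩
    · exact ⟨g₁, g₄⟩
    · rw [show 4 - (3 - η) = 1 + η by ring]
      exact ⟨g₂, g₃⟩
    · rw [sub_sub_cancel]
      exact ⟨g₄, g₁⟩
    · rw [show 4 - (1 + η) = 3 - η by ring]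
      exact ⟨g₃, g₂⟩
  · rintro ⟨h₁, h₂⟩
    rcases cases_of_totPos_four_sub hF hinert h₁ h₂ with h | h | h | ⟨-, h | h⟩
    · exact Or.inl h
    · exact Or.inr (Or.inl h)
    · exact Or.inr (Or.inr (Or.inl h))
    · rcases golden_cases hη h with h | h
      · exact Or.inr (Or.inr (Or.inr (Or.inl h)))
      · exact Or.inr (Or.inr (Or.inr (Or.inr (Or.inl h))))
    · rcases golden_cases hη h with h | h
      · exact Or.inr (Or.inr (Or.inr (Or.inr (Or.inr (Or.inl (by linear_combination -h))))))
      · exact Or.inr (Or.inr (Or.inr (Or.inr (Or.inr (Or.inr (by linear_combination -h))))))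

open Classical in
omit [IsTotallyReal F] in
lemma sum_decomp_three_golden (hη : η ^ 2 = 3 * η - 1) (g : 𝓞 F → ℂ) :
    ∑ α ∈ ({1, 2, η, 3 - η} : Finset (𝓞 F)), g α = g 1 + g 2 + g η + g (3 - η) := by
  obtain ⟨n0, n1, n2, n3, n4⟩ := golden_ne hη
  rw [Finset.sum_insert, Finset.sum_insert, Finset.sum_insert, Finset.sum_singleton]
  · ring
  all_goals
    simp only [Finset.mem_insert, Finset.mem_singleton, not_or]
    grind

open Classical in
omit [IsTotallyReal F] in
lemma sum_decomp_four_golden (hη : η ^ 2 = 3 * η - 1) (g : 𝓞 F → ℂ) :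
    ∑ α ∈ ({1, 2, 3, η, 3 - η, 4 - η, 1 + η} : Finset (𝓞 F)), g α =
      g 1 + g 2 + g 3 + g η + g (3 - η) + g (4 - η) + g (1 + η) := by
  obtain ⟨n0, n1, n2, n3, n4⟩ := golden_ne hη
  rw [Finset.sum_insert, Finset.sum_insert, Finset.sum_insert, Finset.sum_insert,
    Finset.sum_insert, Finset.sum_insert, Finset.sum_singleton]
  · ring
  all_goals
    simp only [Finset.mem_insert, Finset.mem_singleton, not_or]
    grind

end Decompositions

end

end HilbertModular

/-! ### The product formulas -/

open HilbertModular in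
theorem mainTheorem6 {F : Type*} [Field F] [NumberField F] [IsTotallyReal F]
    (hF : Module.finrank ℚ F = 2)
    {N : Type*} (t : N → (FinAdeles F)ˣ) (ht : IsNarrowRepSystem F t)
    (ν₁ : N) (hν₁ : NarrowEquiv 1 (ideleIdeal (t ν₁)))
    (k₁ k₂ : ℤ) (ψ₁ ψ₂ : narrowClassCharacters F)
    (f h : GL (Fin 2) (Adeles F) → ℂ)
    (hf : IsModularFormWithChar k₁ ψ₁ f) (hh : IsModularFormWithChar k₂ ψ₂ h) :
    -- the product lies in the space of weight `k₁ + k₂` and character `ψ₁ψ₂`,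
    -- and it is the tuple of the products of the components
    IsModularFormWithChar (k₁ + k₂) (ψ₁ * ψ₂ : narrowClassCharacters F) (f * h) ∧
    (∀ ν, component (k₁ + k₂) (f * h) (t ν) = component k₁ f (t ν) * component k₂ h (t ν)) ∧
    -- the Fourier expansions exist
    (∀ ν, IsFourierExpansion (component k₁ f (t ν)) (ideleIdeal (t ν)) (compCoeff k₁ f (t ν)) ∧
      IsFourierExpansion (component k₂ h (t ν)) (ideleIdeal (t ν)) (compCoeff k₂ h (t ν)) ∧
      IsFourierExpansion (component (k₁ + k₂) (f * h) (t ν)) (ideleIdeal (t ν))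
        (compCoeff (k₁ + k₂) (f * h) (t ν))) ∧
    -- the constant terms
    (∀ ν, constCoeff (k₁ + k₂) (f * h) (t ν) =
      constCoeff k₁ f (t ν) * constCoeff k₂ h (t ν)) ∧
    -- the ideal `𝒪`
    (coeff t (k₁ + k₂) (f * h) ⊤ =
      coeff t k₁ f ⊤ * constCoeff k₂ h (t ν₁) + coeff t k₂ h ⊤ * constCoeff k₁ f (t ν₁)) ∧
    -- the ideal `(2)`
    (coeff t (k₁ + k₂) (f * h) (Ideal.span {2}) =
      constCoeff k₂ h (t ν₁) * coeff t k₁ f (Ideal.span {2}) +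
      coeff t k₁ f ⊤ * coeff t k₂ h ⊤ +
      constCoeff k₁ f (t ν₁) * coeff t k₂ h (Ideal.span {2})) ∧
    -- the ideal `(4)` when `(2)` is inert
    ((Ideal.span {2} : Ideal (𝓞 F)).IsPrime →
      coeff t (k₁ + k₂) (f * h) (Ideal.span {4}) =
        constCoeff k₂ h (t ν₁) * coeff t k₁ f (Ideal.span {4}) +
        coeff t k₁ f ⊤ * coeff t k₂ h (Ideal.span {3}) +
        coeff t k₁ f (Ideal.span {2}) * coeff t k₂ h (Ideal.span {2}) +
        coeff t k₂ h ⊤ * coeff t k₁ f (Ideal.span {3}) +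
        constCoeff k₁ f (t ν₁) * coeff t k₂ h (Ideal.span {4}) +
        if NumberField.discr F = 5 then
          2 * coeff t k₁ f (different F) * coeff t k₂ h ⊤ +
          2 * coeff t k₁ f ⊤ * coeff t k₂ h (different F)
        else 0) ∧
    -- the ideal `(3)`
    (coeff t (k₁ + k₂) (f * h) (Ideal.span {3}) =
      constCoeff k₂ h (t ν₁) * coeff t k₁ f (Ideal.span {3}) +
      coeff t k₁ f ⊤ * coeff t k₂ h (Ideal.span {2}) +
      coeff t k₂ h ⊤ * coeff t k₁ f (Ideal.span {2}) +
      constCoeff k₁ f (t ν₁) * coeff t k₂ h (Ideal.span {3}) +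
      if NumberField.discr F = 5 then 2 * coeff t k₁ f ⊤ * coeff t k₂ h ⊤ else 0) ∧
    -- a prime above `2` when `2` is ramified or split
    (∀ p : Ideal (𝓞 F), p.IsPrime →
      (Ideal.span {2} = p ^ 2 ∨
        ∃ q : Ideal (𝓞 F), q.IsPrime ∧ q ≠ p ∧ Ideal.span {2} = p * q) →
      ∀ ν, NarrowEquiv (p : FractionalIdeal (𝓞 F)⁰ F) (ideleIdeal (t ν))⁻¹ →
        coeff t (k₁ + k₂) (f * h) p =
          constCoeff k₂ h (t ν) * coeff t k₁ f p + constCoeff k₁ f (t ν) * coeff t k₂ h p) := by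
  have hf' := hf.toIsModularForm
  have hh' := hh.toIsModularForm
  have hF1 : 1 < Module.finrank ℚ F := by omega
  have hspan1 : (Ideal.span {(1 : 𝓞 F)}) = ⊤ := Ideal.span_singleton_one
  have s21 : (2 : 𝓞 F) - 1 = 1 := by norm_num
  have s31 : (3 : 𝓞 F) - 1 = 2 := by norm_num
  have s32 : (3 : 𝓞 F) - 2 = 1 := by norm_num
  have s41 : (4 : 𝓞 F) - 1 = 3 := by norm_num
  have s42 : (4 : 𝓞 F) - 2 = 2 := by norm_num
  have s43 : (4 : 𝓞 F) - 3 = 1 := by norm_num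
  refine ⟨hf.mul hh, fun ν => component_mul k₁ k₂ f h (t ν), fun ν =>
    ⟨hf'.isFourierExpansion _, hh'.isFourierExpansion _, (hf'.mul hh').isFourierExpansion _⟩,
    fun ν => ?_, ?_, ?_, fun hinert => ?_, ?_, fun p hp h2 ν hν =>
      coeff_mul_of_absNorm_eq_two hF ht hf' hh' (absNorm_eq_two hF hp h2) hν⟩
  · rw [constCoeff, constCoeff, constCoeff, compCoeff_mul_zero hF1 hf' hh', normFactor_add]
    ring
  -- `1` has no totally positive decomposition, so the sum is empty.
  · have key := coeff_span_mul hF ht hν₁ hf' hh' (n := 1) totPos_one ∅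
      fun α => by
        simp only [Finset.notMem_empty, false_iff, not_and]
        exact not_totPos_one_sub hF
    rw [hspan1, Finset.sum_empty] at key
    rw [key]
    ring
  · have key := coeff_span_mul hF ht hν₁ hf' hh' (totPos_ofNat 2) {1} (mem_decomp_two hF)
    rw [Finset.sum_singleton, s21, hspan1] at key
    rw [key]
    ring
  · classical
    split_ifs with hD
    · obtain ⟨η, hη⟩ := exists_golden hF hD
      have key := coeff_span_mul hF ht hν₁ hf' hh' (totPos_ofNat 4) _
        (mem_decomp_four_golden hF hinert hη)
      have e1 : (4 : 𝓞 F) - (3 - η) = 1 + η := by ring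
      have e2 : (4 : 𝓞 F) - (1 + η) = 3 - η := by ring
      -- The four irrational terms pair a unit with a generator of `𝔡`. Each order of the factors
      -- occurs twice, whence the coefficients `2` in `ε₄`.
      rw [sum_decomp_four_golden hη, s41, s42, s43, hspan1, e1, e2, sub_sub_cancel,
        (span_golden hη).1, (span_golden hη).2, span_four_sub_golden hη,
        ← different_eq_span hF hD hη] at key
      rw [key]
      ring
    · have key := coeff_span_mul hF ht hν₁ hf' hh' (totPos_ofNat 4) _
        (mem_decomp_four hF hinert hD)
      rw [Finset.sum_insert (by norm_num), Finset.sum_pair (by norm_num), s41, s42, s43,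
        hspan1] at key
      rw [key]
      ring
  · classical
    split_ifs with hD
    · obtain ⟨η, hη⟩ := exists_golden hF hD
      have key := coeff_span_mul hF ht hν₁ hf' hh' (totPos_ofNat 3) _
        (mem_decomp_three_golden hF hη)
      -- In `3 = η + (3 - η)` both parts are units, and the two orders give the factor `2` in `ε₃`.
      rw [sum_decomp_three_golden hη, s31, s32, hspan1, sub_sub_cancel,
        (span_golden hη).1, (span_golden hη).2] at key
      rw [key]
      ring
    · have key := coeff_span_mul hF ht hν₁ hf' hh' (totPos_ofNat 3) _ (mem_decomp_three hF hD)
      rw [Finset.sum_pair (by norm_num), s31, s32, hspan1] at key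
      rw [key]
      ring
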